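/- A real algebraic integer $\lambda\ge 1$ is called \emph{Perron} if $|\lambda'|<\lambda$ for every other Galois conjugate $\lambda'$ of $\lambda$; its \emph{spectral ratio} is $\rho=\max|\lambda'|/\lambda$ over the Galois conjugates $\lambda'\ne\lambda$. A non-negative square matrix is \emph{primitive} if some power of it has only positive entries, and the \emph{Perron--Frobenius degree} $d_{PF}(\lambda)$ is the least dimension of a primitive matrix with integer entries and spectral radius $\lambda$ (such matrices exist). For a number field $K$ of degree $d$ with $r$ real embeddings $\sigma_1,\dots,\sigma_r$ and $s$ pairs of complex embeddings, represented by $\sigma_{r+1},\dots,\sigma_{r+s}$, view the ring of integers $\mathcal O_K$ as a lattice in $\mathbb R^r\times\mathbb C^s$ through $(\sigma_1,\dots,\sigma_{r+s})$. For $\alpha\in(\mathbb R_{>0})^{r+s}$ let $q_\alpha(x,y)=\sum_{i\le r}\alpha_i x_i y_i+\sum_{j>r}2\alpha_j\,\mathrm{Re}(x_j\overline{y_j})$, let $\max(\mathcal O_K,q_\alpha)$ be the infimum of the real $u$ such that for every $x\in\mathbb R^r\times\mathbb C^s$ there is $y\in\mathcal O_K$ with $q_\alpha(x-y,x-y)\le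 u$, and let $\det(\mathcal O_K,q_\alpha)$ be the determinant of the Gram matrix of $q_\alpha$ in a $\mathbb Z$-basis of $\mathcal O_K$. The \emph{minimal Hermite-like thickness} is $\tau_{\min}(\mathcal O_K)=\inf_\alpha \max(\mathcal O_K,q_\alpha)/\det(\mathcal O_K,q_\alpha)^{1/d}$. Let $D_K$ be the discriminant of $K$. \textbf{Theorem.} Let $\lambda$ be a Perron number of degree $d\ge 3$ with spectral ratio $\rho$, and let $K=\mathbb Q(\lambda)\subset\mathbb R$. Let $\kappa(K,\rho)$ be the maximum of $d_{PF}(\alpha)$ over the Perron numbers $\alpha\in K\cap[1,1+\tfrac{4}{1-\rho}]$. Then \[ d_{PF}(\lambda)\le\max\{2^{d^2}B(K,\rho),\ \kappa(K,\rho)\}, \] where $B(K,\rho)$ may be taken to be either of \[ \Big(\frac{8d}{1-\rho}\Big)^{d^2}\tau_{\min}(\mathcal O_K)^{d/2}\qquad\text{and}\qquad \Big(\frac{8d}{1-\rho}\Big)^{d^2}\sqrt{|D_K|}. \] -/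

import Mathlib

open NumberField NumberField.InfinitePlace
open scoped IntermediateField

/-! ### Perron numbers -/

/-- A real algebraic integer `lam ≥ 1` is *Perron* if it is strictly larger in absolute value than
all its other Galois conjugates (the other complex roots of its minimal polynomial over `ℚ`). -/
structure IsPerron (lam : ℝ) : Prop where
  isIntegral : IsIntegral ℤ lam
  one_le : 1 ≤ lam
  norm_lt : ∀ z ∈ (minpoly ℚ lam).rootSet ℂ, z ≠ (lam : ℂ) → ‖z‖ < lam

/-- The spectral ratio of `lam`: the maximum of `|z| / lam` over the Galois conjugates `z ≠ lam`
of `lam`. -/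
noncomputable def spectralRatio (lam : ℝ) : ℝ :=
  sSup {r : ℝ | ∃ z ∈ (minpoly ℚ lam).rootSet ℂ, z ≠ (lam : ℂ) ∧ r = ‖z‖ / lam}

/-- The field `ℚ(lam)` generated by a Perron number is a number field. -/
theorem IsPerron.numberField {lam : ℝ} (h : IsPerron lam) : NumberField ℚ⟮lam⟯ where
  to_charZero := inferInstance
  to_finiteDimensional := IntermediateField.adjoin.finiteDimensional h.isIntegral.tower_top

/-! ### The Perron–Frobenius degree -/

/-- The dimensions `n` of the primitive `n × n` integral matrices with spectral radius `lam`. -/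
def primitiveDims (lam : ℝ) : Set ℕ :=
  {n : ℕ | ∃ A : Matrix (Fin n) (Fin n) ℤ,
    A.IsPrimitive ∧ spectralRadius ℂ (A.map (Int.cast : ℤ → ℂ)) = ENNReal.ofReal lam}

/-- The Perron–Frobenius degree: the least dimension of a primitive integral matrix with spectral
radius `lam`. -/
noncomputable def dPF (lam : ℝ) : ℕ := sInf (primitiveDims lam)

/-- `κ(K, ρ)`: the largest Perron–Frobenius degree of a Perron number lying in
`[1, 1 + 4 / (1 - ρ)] ∩ K`. -/
noncomputable def kappa (K : IntermediateField ℚ ℝ) (ρ : ℝ) : ℕ :=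
  sSup (dPF '' {a : ℝ | IsPerron a ∧ a ∈ K ∧ a ∈ Set.Icc 1 (1 + 4 / (1 - ρ))})

/-- In a number field there are only finitely many Perron numbers below a given bound. -/
theorem finite_perron (K : IntermediateField ℚ ℝ) [FiniteDimensional ℚ K] (M : ℝ) :
    {a : ℝ | IsPerron a ∧ a ∈ K ∧ a ∈ Set.Icc 1 M}.Finite := by
  have : NumberField K := {}
  refine ((NumberField.Embeddings.finite_of_norm_le K ℂ M).image (fun x : K => (x : ℝ))).subset ?_
  rintro a ⟨ha, haK, -, haM⟩
  refine ⟨⟨a, haK⟩, ⟨?_, fun φ => ?_⟩, rfl⟩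
  · exact (isIntegral_algHom_iff (K.val.restrictScalars ℤ) Subtype.val_injective).1 ha.isIntegral
  · have hmin : minpoly ℚ (⟨a, haK⟩ : K) = minpoly ℚ a :=
      (minpoly.algHom_eq K.val Subtype.val_injective (⟨a, haK⟩ : K)).symm
    have hroot : φ ⟨a, haK⟩ ∈ (minpoly ℚ a).rootSet ℂ := by
      rw [Polynomial.mem_rootSet, ← hmin]
      refine ⟨minpoly.ne_zero (Algebra.IsIntegral.isIntegral _), ?_⟩
      have := Polynomial.aeval_algHom_apply φ.toRatAlgHom (⟨a, haK⟩ : K)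
        (minpoly ℚ (⟨a, haK⟩ : K))
      rw [minpoly.aeval, map_zero] at this
      exact this
    by_cases h : φ ⟨a, haK⟩ = (a : ℂ)
    · rw [h, Complex.norm_real, Real.norm_of_nonneg (zero_le_one.trans ha.one_le)]
      exact haM
    · exact (ha.norm_lt _ hroot h).le.trans haM

theorem isPerron_one : IsPerron 1 where
  isIntegral := isIntegral_one
  one_le := le_rfl
  norm_lt := by
    intro z hz hne
    rw [minpoly.one, Polynomial.mem_rootSet] at hz
    exact absurd (by simpa [sub_eq_zero] using hz.2) hne

/-- The maximum defining `κ(K, ρ)` exists. -/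
theorem isGreatest_kappa (K : IntermediateField ℚ ℝ) [FiniteDimensional ℚ K] {ρ : ℝ}
    (hρ : ρ < 1) :
    IsGreatest (dPF '' {a : ℝ | IsPerron a ∧ a ∈ K ∧ a ∈ Set.Icc 1 (1 + 4 / (1 - ρ))})
      (kappa K ρ) := by
  have hfin := (finite_perron K (1 + 4 / (1 - ρ))).image dPF
  have h4 : 0 ≤ 4 / (1 - ρ) := div_nonneg (by norm_num) (sub_nonneg.2 hρ.le)
  exact ⟨Nat.sSup_mem ⟨dPF 1, 1, ⟨isPerron_one, one_mem K, le_rfl, by linarith⟩, rfl⟩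
    hfin.bddAbove, fun _ h => le_csSup hfin.bddAbove h⟩

/-! ### The minimal Hermite-like thickness -/

section Thickness

variable (K : Type*) [Field K] [NumberField K]

open Classical in
/-- The bilinear form `q_α(x, y) = Trace(α x ȳ)` on `K ⊗ ℝ = ℝ^r × ℂ^s`, where `α` assigns a real
number to each infinite place and `Trace(x) = ∑ x_i + ∑ (x_j + conj x_j)`. -/
noncomputable def qForm (α : InfinitePlace K → ℝ) (x y : mixedEmbedding.mixedSpace K) : ℝ :=
  ∑ w, α w.1 * x.1 w * y.1 w +
    ∑ w, 2 * ((α w.1 : ℂ) * x.2 w * (starRingEnd ℂ) (y.2 w)).re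

/-- The maximum of the lattice `(𝓞 K, q_α)`, i.e. the square of its covering radius. -/
noncomputable def latticeMax (α : InfinitePlace K → ℝ) : ℝ :=
  sInf {u : ℝ | ∀ x : mixedEmbedding.mixedSpace K, ∃ y : 𝓞 K,
    qForm K α (x - mixedEmbedding K y) (x - mixedEmbedding K y) ≤ u}

/-- The determinant of the lattice `(𝓞 K, q_α)`: the determinant of the Gram matrix of `q_α` in a
`ℤ`-basis of `𝓞 K`. -/
noncomputable def latticeDet (α : InfinitePlace K → ℝ) : ℝ :=
  (Matrix.of fun i j => qForm K α (mixedEmbedding K (RingOfIntegers.basis K i))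
    (mixedEmbedding K (RingOfIntegers.basis K j))).det

/-- The Hermite-like thickness of `(𝓞 K, q_α)`. -/
noncomputable def thickness (α : InfinitePlace K → ℝ) : ℝ :=
  latticeMax K α / latticeDet K α ^ (1 / (Module.finrank ℚ K : ℝ))

/-- The minimal Hermite-like thickness `τ_min(𝓞 K)`: the infimum of the Hermite-like thickness of
`(𝓞 K, q_α)` over all `α` with positive components. -/
noncomputable def tauMin : ℝ :=
  sInf {t : ℝ | ∃ α : InfinitePlace K → ℝ, (∀ w, 0 < α w) ∧ t = thickness K α}

/-- The thickness bound `(8d / (1 - ρ))^(d²) τ_min(𝓞 K)^(d/2)`, `d = [K : ℚ]`. -/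
noncomputable def boundThickness (ρ : ℝ) : ℝ :=
  (8 * (Module.finrank ℚ K : ℝ) / (1 - ρ)) ^ (Module.finrank ℚ K ^ 2) *
    tauMin K ^ ((Module.finrank ℚ K : ℝ) / 2)

/-- The discriminant bound `(8d / (1 - ρ))^(d²) |D_K|^(1/2)`, `d = [K : ℚ]`. -/
noncomputable def boundDiscr (ρ : ℝ) : ℝ :=
  (8 * (Module.finrank ℚ K : ℝ) / (1 - ρ)) ^ (Module.finrank ℚ K ^ 2) *
    Real.sqrt |(discr K : ℝ)|

end Thickness

/-! ### Spectral radius and primitivity of decomposition matrices -/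

/-! Suppose a finite set `S` of integers of `K`, positive at the inclusion place, is such that `λx`
is a sum of elements of `S` for every `x ∈ S`. The matrix of multiplicities is nonnegative, and the
values of the elements form a positive eigenvector for `λ`, so the spectral radius is `λ`. If a
fixed `c` is a summand of every `λx`, discarding what is not reachable from `c` leaves a primitive
matrix (`exists_mem_primitiveDims_le_card`). So the degree is at most the size of `S`.

Take for `S` the integers in a cone around the inclusion place, of height between two multiples of
`μ / (1 - ρ)`, where every point lies within `μ` of an integer at each weighted place.
Multiplication by `λ` contracts the cone by `ρ`. For `λ > 1 + 4 / (1 - ρ)`, subtracting `c` keeps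
`λx` well inside the cone; cutting the segment from `0` to `λx - c` into equal steps and rounding
the division points to integers gives the summands (`exists_multiset_sum_eq`). For smaller `λ` the
bound is the definition of `κ`.

A volume comparison counts the integers in a box (`ncard_integers_place_le`). With weights `√α` and
`μ` close to the covering radius of `q_α`, the determinant cancels, leaving `(60 / (1 - ρ)) ^ d *
τ_min ^ (d / 2)`.

For the discriminant bound, slicing the lattice by hyperplanes orthogonal to a short dual vector
bounds the covering radius by the dual minimum (`exists_norm_sub_sq_le`). Dual vectors come from the
trace dual of `𝓞 K`, where nonzero norms are at least `1 / |D_K|`; so `τ_min ≤ 2 ^ (d + 1) * |D_K| ^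
(1 / d)`. -/

/-- A nonnegative matrix with a positive eigenvector has spectral radius the eigenvalue. -/
theorem spectralRadius_eq_of_pos_eigenvector {ι : Type*} [Fintype ι] [DecidableEq ι] [Nonempty ι]
    (A : Matrix ι ι ℤ) (hA : ∀ i j, 0 ≤ A i j) (v : ι → ℝ) (hv : ∀ i, 0 < v i) {lam : ℝ}
    (hlam : 0 ≤ lam) (h : ∀ i, ∑ j, (A i j : ℝ) * v j = lam * v i) :
    spectralRadius ℂ (A.map (Int.cast : ℤ → ℂ)) = ENNReal.ofReal lam := by
  set B := A.map (Int.cast : ℤ → ℂ) with hB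
  have hspec : ∀ z : ℂ, z ∈ spectrum ℂ B ↔ ∃ x : ι → ℂ, x ≠ 0 ∧ B.mulVec x = z • x := by
    intro z
    rw [← Matrix.spectrum_toLin', ← Module.End.hasEigenvalue_iff_mem_spectrum]
    constructor
    · intro hz
      obtain ⟨x, hx⟩ := hz.exists_hasEigenvector
      exact ⟨x, hx.2, by simpa using hx.apply_eq_smul⟩
    · rintro ⟨x, hx0, hx⟩
      exact Module.End.hasEigenvalue_of_hasEigenvector (x := x)
        ⟨Module.End.mem_eigenspace_iff.2 (by simpa using hx), hx0⟩
  apply le_antisymm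
  · refine iSup₂_le fun z hz => ?_
    obtain ⟨x, hx0, hx⟩ := (hspec z).1 hz
    -- In the sup norm weighted by `v`, the matrix has operator norm at most `lam`; `i` is a
    -- coordinate where the eigenvector attains its norm.
    obtain ⟨i, -, hi⟩ := Finset.exists_max_image Finset.univ (fun i => ‖x i‖ / v i)
      Finset.univ_nonempty
    have hxi : 0 < ‖x i‖ := by
      obtain ⟨j, hj⟩ := Function.ne_iff.1 hx0
      have h1 : 0 < ‖x j‖ / v j := div_pos (norm_pos_iff.2 hj) (hv j)
      exact (div_pos_iff_of_pos_right (hv i)).1 (h1.trans_le (hi j (Finset.mem_univ _)))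
    have key : ‖z‖ * ‖x i‖ ≤ lam * ‖x i‖ := by
      have h1 : ∑ j, (A i j : ℂ) * x j = z * x i := by
        simpa [Matrix.mulVec, dotProduct, hB] using congrFun hx i
      calc ‖z‖ * ‖x i‖ = ‖∑ j, (A i j : ℂ) * x j‖ := by rw [h1, norm_mul]
        _ ≤ ∑ j, (A i j : ℝ) * (‖x i‖ / v i * v j) := by
            refine norm_sum_le_of_le _ fun j _ => ?_
            rw [norm_mul, Complex.norm_intCast, abs_of_nonneg (by exact_mod_cast hA i j)]
            refine mul_le_mul_of_nonneg_left ?_ (by exact_mod_cast hA i j)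
            exact (div_le_iff₀ (hv j)).1 (hi j (Finset.mem_univ _))
        _ = ‖x i‖ / v i * ∑ j, (A i j : ℝ) * v j := by
            rw [Finset.mul_sum]; exact Finset.sum_congr rfl fun j _ => by ring
        _ = lam * ‖x i‖ := by rw [h i]; field_simp [(hv i).ne']
    rw [← ENNReal.ofReal_coe_nnreal, coe_nnnorm]
    exact ENNReal.ofReal_le_ofReal (le_of_mul_le_mul_right key hxi)
  · have hmem : (lam : ℂ) ∈ spectrum ℂ B := by
      refine (hspec _).2 ⟨fun i => (v i : ℂ), ?_, ?_⟩
      · obtain ⟨i⟩ := ‹Nonempty ι›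
        exact fun h0 => (hv i).ne' (by simpa using congrFun h0 i)
      · ext i
        have := congrArg (fun t : ℝ => (t : ℂ)) (h i)
        simpa [Matrix.mulVec, dotProduct, hB] using this
    refine le_trans (le_of_eq ?_) (le_iSup₂ (f := fun k _ => (‖k‖₊ : ENNReal)) (lam : ℂ) hmem)
    rw [← ENNReal.ofReal_coe_nnreal, coe_nnnorm, Complex.norm_real, Real.norm_of_nonneg hlam]

/-- There is a walk of length `n` from `x` to `y` in the graph with edges `x → y`, `y ∈ m x`. -/
def HasWalk {β : Type*} (m : β → Multiset β) : ℕ → β → β → Prop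
  | 0, x, y => x = y
  | n + 1, x, y => ∃ z ∈ m x, HasWalk m n z y

theorem HasWalk.trans {β : Type*} {m : β → Multiset β} {k l : ℕ} {x y z : β}
    (h1 : HasWalk m k x y) (h2 : HasWalk m l y z) : HasWalk m (k + l) x z := by
  induction k generalizing x with
  | zero => rw [zero_add]; exact (show x = y from h1) ▸ h2
  | succ k ih =>
    obtain ⟨u, hu, h⟩ := h1
    rw [Nat.add_right_comm]
    exact ⟨u, hu, ih h⟩

theorem HasWalk.single {β : Type*} {m : β → Multiset β} {x y : β} (h : y ∈ m x) :
    HasWalk m 1 x y := ⟨y, h, rfl⟩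

theorem HasWalk.mem {β : Type*} {m : β → Multiset β} {S : Set β}
    (hS : ∀ x ∈ S, ∀ y ∈ m x, y ∈ S) {n : ℕ} {x y : β} (hx : x ∈ S) (h : HasWalk m n x y) :
    y ∈ S := by
  induction n generalizing x with
  | zero => exact (show x = y from h) ▸ hx
  | succ n ih =>
    obtain ⟨u, hu, h⟩ := h
    exact ih (hS x hx u hu) h

open Classical in
/-- A system of decompositions of `lam * x` into elements of a finite set, all of whose elements are
reachable from `w` and lead to `w`, gives a primitive matrix with spectral radius `lam`. -/
theorem mem_primitiveDims_of_reachable {β : Type*} (S : Finset β) (v : β → ℝ)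
    (hv : ∀ x ∈ S, 0 < v x) {lam : ℝ} (hlam : 0 ≤ lam) (m : β → Multiset β)
    (hm : ∀ x ∈ S, ∀ y ∈ m x, y ∈ S) (hsum : ∀ x ∈ S, ((m x).map v).sum = lam * v x)
    (w : β) (hw : w ∈ S) (hreach : ∀ x ∈ S, ∃ k, HasWalk m k w x) (N : ℕ)
    (hN : ∀ x ∈ S, ∀ n, N ≤ n → HasWalk m n x w) : S.card ∈ primitiveDims lam := by
  let e : Fin S.card ≃ S := S.equivFin.symm
  let A : Matrix (Fin S.card) (Fin S.card) ℤ := fun i j => (m (e i)).count (e j : β)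
  have hA : ∀ i j, 0 ≤ A i j := fun i j => Int.natCast_nonneg _
  have : Nonempty (Fin S.card) := ⟨e.symm ⟨w, hw⟩⟩
  have hwalk : ∀ n i j, HasWalk m n (e i : β) (e j : β) → 0 < (A ^ n) i j := by
    intro n
    induction n with
    | zero =>
      intro i j h
      have : i = j := e.injective (Subtype.ext h)
      simp [this]
    | succ n ih =>
      rintro i j ⟨u, hu, h⟩
      have huS : u ∈ S := hm _ (e i).2 u hu
      rw [pow_succ', Matrix.mul_apply]
      refine Finset.sum_pos' (fun k _ => mul_nonneg (hA i k) ?_)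
        ⟨e.symm ⟨u, huS⟩, Finset.mem_univ _, mul_pos ?_ (ih _ _ (by simpa using h))⟩
      · have : ∀ n i j, 0 ≤ (A ^ n) i j := by
          intro n
          induction n with
          | zero => intro i j; rw [pow_zero, Matrix.one_apply]; split_ifs <;> simp
          | succ n ih =>
            intro i j
            rw [pow_succ', Matrix.mul_apply]
            exact Finset.sum_nonneg fun k _ => mul_nonneg (hA i k) (ih k j)
        exact this n k j
      · simpa [A, Multiset.count_pos] using hu
  refine ⟨A, ⟨hA, ?_⟩, ?_⟩
  · choose! k hk using hreach
    obtain ⟨M, hM⟩ : ∃ M, ∀ x ∈ S, k x ≤ M := ⟨S.sup k, fun x hx => Finset.le_sup hx⟩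
    -- Walks to `w` exist in every length from `N` on, so the first leg absorbs the varying length
    -- `k (e j)` of the second; the `+ 1` makes the exponent positive.
    refine ⟨N + M + 1, Nat.succ_pos _, fun i j => hwalk _ _ _ ?_⟩
    have h1 := hN _ (e i).2 (N + M + 1 - k (e j)) (by have := hM _ (e j).2; omega)
    have h2 := h1.trans (hk _ (e j).2)
    rwa [Nat.sub_add_cancel (by have := hM _ (e j).2; omega)] at h2
  · refine spectralRadius_eq_of_pos_eigenvector A hA (fun i => v (e i)) (fun i => hv _ (e i).2)
      hlam fun i => ?_
    rw [← hsum _ (e i).2, Finset.sum_multiset_map_count]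
    have hsub : (m (e i)).toFinset ⊆ S := fun y hy => hm _ (e i).2 y (Multiset.mem_toFinset.1 hy)
    rw [Finset.sum_subset hsub (fun y _ hy => by
      rw [Multiset.count_eq_zero_of_notMem (by simpa using hy), zero_smul])]
    rw [← Finset.sum_coe_sort S, ← e.sum_comp]
    exact Finset.sum_congr rfl fun j _ => by simp [A]

open Classical in
/-- The elements not reachable from `w` can be discarded. -/
theorem exists_mem_primitiveDims_le_card {β : Type*} (S : Finset β) (v : β → ℝ)
    (hv : ∀ x ∈ S, 0 < v x) {lam : ℝ} (hlam : 0 ≤ lam) (m : β → Multiset β)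
    (hm : ∀ x ∈ S, ∀ y ∈ m x, y ∈ S) (hsum : ∀ x ∈ S, ((m x).map v).sum = lam * v x)
    (w : β) (hw : w ∈ S) (N : ℕ) (hN : ∀ x ∈ S, ∀ n, N ≤ n → HasWalk m n x w) :
    ∃ n ∈ primitiveDims lam, n ≤ S.card := by
  refine ⟨_, mem_primitiveDims_of_reachable (S.filter fun x => ∃ k, HasWalk m k w x) v
    (fun x hx => hv x (Finset.mem_filter.1 hx).1) hlam m ?_
    (fun x hx => hsum x (Finset.mem_filter.1 hx).1) w
    (Finset.mem_filter.2 ⟨hw, 0, rfl⟩) (fun x hx => (Finset.mem_filter.1 hx).2) N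
    (fun x hx => hN x (Finset.mem_filter.1 hx).1), Finset.card_filter_le _ _⟩
  intro x hx y hy
  obtain ⟨hxS, k, hk⟩ := Finset.mem_filter.1 hx
  exact Finset.mem_filter.2 ⟨hm x hxS y hy, k + 1, hk.trans (.single hy)⟩

/-! ### Decomposing integers of a number field into small pieces -/

theorem place_value_sum {K : Type*} [Field K] (j : K →+* ℝ) (a : ℝ) (s : Multiset (𝓞 K)) :
    a * j (s.sum : 𝓞 K) = (s.map fun x : 𝓞 K => a * j (x : K)).sum := by
  induction s using Multiset.induction_on with
  | empty => simp
  | cons b s ih =>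
    rw [Multiset.map_cons, Multiset.sum_cons, Multiset.sum_cons, ← ih]
    push_cast
    rw [map_add, mul_add]

section Decomposition

variable {K : Type*} [Field K] [NumberField K]

theorem finite_integers_place_le (g : InfinitePlace K → ℝ) (hg : ∀ w, 0 < g w) (c : ℝ) :
    {x : 𝓞 K | ∀ w : InfinitePlace K, g w * w (x : K) ≤ c}.Finite := by
  have hB : ∃ B, ∀ w, c / g w ≤ B := by
    obtain ⟨B, hB⟩ := (Set.finite_range fun w => c / g w).bddAbove
    exact ⟨B, fun w => hB ⟨w, rfl⟩⟩
  obtain ⟨B, hB⟩ := hB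
  refine Set.Finite.of_finite_image ((NumberField.Embeddings.finite_of_norm_le K ℂ B).subset ?_)
    (RingOfIntegers.coe_injective.injOn (f := fun x : 𝓞 K => (x : K)))
  rintro _ ⟨x, hx, rfl⟩
  refine ⟨x.isIntegral_coe, (le_iff_le _ _).1 fun w => le_trans ?_ (hB w)⟩
  rw [le_div_iff₀ (hg w), mul_comm]
  exact hx w

/-- If every element of `K` is within `μ` of the ring of integers, then an integer deep inside the
cone around a real place is a sum of integers of moderate size in the cone. -/
theorem exists_multiset_sum_eq (j : K →+* ℝ) (w₀ : InfinitePlace K) (hw₀ : ∀ x, w₀ x = |j x|)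
    (g : InfinitePlace K → ℝ) (hg : ∀ w, 0 < g w) {μ : ℝ} (hμ : 0 ≤ μ)
    (cov : ∀ x : K, ∃ y : 𝓞 K, ∀ w : InfinitePlace K, g w * w (x - y) ≤ μ)
    {z : 𝓞 K} {θ h : ℝ}
    (hz : ∀ w ≠ w₀, g w * w (z : K) ≤ θ * (g w₀ * j z)) (hh0 : 0 < h) (hh : h ≤ g w₀ * j z)
    (hμh : 4 * μ ≤ (1 - θ) * h) :
    ∃ m : Multiset (𝓞 K), m.sum = z ∧ ∀ y ∈ m, (∀ w ≠ w₀, g w * w (y : K) ≤ g w₀ * j y) ∧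
      h - 2 * μ ≤ g w₀ * j y ∧ g w₀ * j y ≤ 2 * h + 2 * μ := by
  choose r hr using cov
  set V := g w₀ * j z with hV
  have hθ : θ ≤ 1 := by
    by_contra! hθ
    nlinarith
  -- This number of steps puts the height of `z / n` between `h` and `2 * h`.
  set n := ⌊V / h⌋₊ with hn
  have hn1 : 1 ≤ n := Nat.le_floor (by rw [Nat.cast_one, le_div_iff₀ hh0]; linarith)
  have hn0 : (0 : ℝ) < n := by exact_mod_cast hn1
  have hnK : (n : K) ≠ 0 := by exact_mod_cast (by omega : n ≠ 0)
  have hlow : h ≤ V / n := by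
    rw [le_div_iff₀ hn0, mul_comm, ← le_div_iff₀ hh0]
    exact Nat.floor_le (div_nonneg (hh0.le.trans hh) hh0.le)
  have hupp : V / n ≤ 2 * h := by
    rw [div_le_iff₀ hn0]
    have h1 : V / h < n + 1 := Nat.lt_floor_add_one _
    rw [div_lt_iff₀ hh0] at h1
    have : (1 : ℝ) ≤ n := by exact_mod_cast hn1
    nlinarith
  -- Roundings of the points `i z / n`, exact at both ends so that the differences telescope to `z`.
  let Z : ℕ → 𝓞 K := fun i => if i = 0 then 0 else if i = n then z else r (i * z / n)
  have hZ : ∀ i : ℕ, ∀ w : InfinitePlace K, g w * w ((i : K) * z / n - Z i) ≤ μ := by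
    intro i w
    by_cases h0 : i = 0
    · simp [Z, h0, hμ]
    by_cases h1 : i = n
    · have : (i : K) * z / n - Z i = 0 := by
        simp only [Z, h1, if_neg (show n ≠ 0 by omega), if_true]
        field_simp
        simp
      rw [this, map_zero, mul_zero]; exact hμ
    · simp only [Z, if_neg h0, if_neg h1]
      exact hr _ w
  refine ⟨(Multiset.range n).map fun i => Z (i + 1) - Z i, ?_, ?_⟩
  · have := Finset.sum_range_sub Z n
    rw [Finset.sum_eq_multiset_sum, Finset.range_val] at this
    rw [this]
    simp [Z, show n ≠ 0 by omega]
  · intro y hy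
    obtain ⟨i, -, rfl⟩ := Multiset.mem_map.1 hy
    set y := Z (i + 1) - Z i with hy
    have hyw : ∀ w : InfinitePlace K, g w * w ((y : K) - z / n) ≤ 2 * μ := by
      intro w
      have e1 : (y : K) - z / n = ((i : K) * z / n - Z i) - (((i + 1 : ℕ) : K) * z / n - Z (i + 1)) := by
        rw [hy]; push_cast; ring
      have h1 : w ((y : K) - z / n) ≤
          w ((i : K) * z / n - Z i) + w (((i + 1 : ℕ) : K) * z / n - Z (i + 1)) := by
        rw [e1]; exact w.1.sub_le_add _ _
      have := mul_le_mul_of_nonneg_left h1 (hg w).le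
      linarith [hZ i w, hZ (i + 1) w]
    have hj : |g w₀ * j y - V / n| ≤ 2 * μ := by
      have := hyw w₀
      rw [hw₀, map_sub, map_div₀, map_natCast] at this
      rw [← abs_of_pos (hg w₀), ← abs_mul] at this
      rwa [hV, mul_div_assoc, ← mul_sub]
    obtain ⟨hj1, hj2⟩ := abs_le.1 hj
    refine ⟨fun w hw => ?_, by linarith, by linarith⟩
    have h1 : w (y : K) ≤ w ((y : K) - z / n) + w (z : K) / n := by
      have h2 := w.1.add_le ((y : K) - z / n) (z / n)
      have h3 : w ((z : K) / n) = w (z : K) / n := by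
        rw [map_div₀, ← norm_embedding_eq w (n : K), map_natCast, Complex.norm_natCast]
      rw [sub_add_cancel] at h2
      exact h2.trans_eq (congrArg _ h3)
    have h2 := mul_le_mul_of_nonneg_left h1 (hg w).le
    have h3 : g w * (w (z : K) / n) ≤ θ * (V / n) := by
      rw [← mul_div_assoc, ← mul_div_assoc]
      exact div_le_div_of_nonneg_right (hz w hw) hn0.le
    -- Rounding costs `2 * μ` at `w` and `2 * μ` in height; the gap between the `θ`-cone and the
    -- full cone at `z / n` is at least `4 * μ`.
    have h4 : (1 - θ) * h ≤ (1 - θ) * (V / n) := mul_le_mul_of_nonneg_left hlow (by linarith)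
    have h5 := hyw w
    rw [mul_add] at h2
    nlinarith

/-- When `λ` is large, every integer of moderate size in the cone is, after multiplication by `λ`,
the sum of a fixed integer and of integers of moderate size in the cone. -/
theorem exists_primitiveDims_le_of_large (j : K →+* ℝ) (w₀ : InfinitePlace K)
    (hw₀ : ∀ x, w₀ x = |j x|) (g : InfinitePlace K → ℝ) (hg : ∀ w, 0 < g w) {μ : ℝ} (hμ : 0 < μ)
    (cov : ∀ x : K, ∃ y : 𝓞 K, ∀ w : InfinitePlace K, g w * w (x - y) ≤ μ)
    {Λ : 𝓞 K} {lam ρ : ℝ} (hΛ : j Λ = lam) (hρ0 : 0 ≤ ρ) (hρ : ρ < 1)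
    (hΛw : ∀ w ≠ w₀, w (Λ : K) ≤ ρ * lam) (hlarge : 1 + 4 / (1 - ρ) < lam)
    (hcenter : ∀ h : ℝ, ∃ y : 𝓞 K, |g w₀ * j y - h| ≤ μ ∧ ∀ w ≠ w₀, g w * w (y : K) ≤ μ) :
    ∃ n ∈ primitiveDims lam,
      n ≤ {x : 𝓞 K | ∀ w : InfinitePlace K, g w * w (x : K) ≤ 18 * μ / (1 - ρ)}.ncard := by
  have hρ' : 0 < 1 - ρ := by linarith
  -- Chosen so that `(1 - θ) * h = 4 * μ` for `θ = (1 + ρ) / 2`. As `μ ≤ h / 8`, summands of height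
  -- between `h - 2μ` and `2h + 2μ` fall in the window from `3/4 h` to `9/4 h`.
  set h := 8 * μ / (1 - ρ) with hh
  have hh1 : h * (1 - ρ) = 8 * μ := by rw [hh]; field_simp
  have hh8 : 8 * μ ≤ h := by nlinarith
  have hlam5 : 5 < lam := by
    have : 4 ≤ 4 / (1 - ρ) := by rw [le_div_iff₀ hρ']; linarith
    linarith
  have hlam4 : 4 < lam * (1 - ρ) := by
    have : 4 / (1 - ρ) * (1 - ρ) = 4 := by field_simp
    nlinarith
  obtain ⟨c, hc, hcw⟩ := hcenter h
  obtain ⟨hc1, hc2⟩ := abs_le.1 hc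
  set T : Set (𝓞 K) := {x | (∀ w ≠ w₀, g w * w (x : K) ≤ g w₀ * j x) ∧ 3 / 4 * h ≤ g w₀ * j x ∧
    g w₀ * j x ≤ 9 / 4 * h} with hT
  have hTsub : T ⊆ {x : 𝓞 K | ∀ w : InfinitePlace K, g w * w (x : K) ≤ 18 * μ / (1 - ρ)} := by
    rintro x ⟨hx1, hx2, hx3⟩ w
    have e : 18 * μ / (1 - ρ) = 9 / 4 * h := by rw [hh]; ring
    rw [e]
    by_cases hw : w = w₀
    · rw [hw, hw₀, abs_of_pos]
      · exact hx3
      · exact (mul_pos_iff_of_pos_left (hg w₀)).1 (by linarith)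
    · exact (hx1 w hw).trans hx3
  have hfin := finite_integers_place_le g hg (18 * μ / (1 - ρ))
  have hTfin : T.Finite := hfin.subset hTsub
  have hcT : c ∈ T := ⟨fun w hw => (hcw w hw).trans (by linarith), by linarith, by linarith⟩
  have hdec : ∀ x ∈ T, ∃ m : Multiset (𝓞 K), m.sum = Λ * x - c ∧ ∀ y ∈ m, y ∈ T := by
    rintro x ⟨hx1, hx2, hx3⟩
    have hv : g w₀ * j (Λ * x - c : 𝓞 K) = lam * (g w₀ * j x) - g w₀ * j c := by
      push_cast
      rw [map_sub, map_mul, hΛ]; ring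
    have hz1 : ∀ w ≠ w₀, g w * w ((Λ * x - c : 𝓞 K) : K) ≤
        (1 + ρ) / 2 * (g w₀ * j (Λ * x - c : 𝓞 K)) := by
      intro w hw
      rw [hv]
      have h1 : w ((Λ * x - c : 𝓞 K) : K) ≤ w (Λ : K) * w (x : K) + w (c : K) := by
        push_cast
        rw [← map_mul w]
        exact w.1.sub_le_add _ _
      have h2 := mul_le_mul_of_nonneg_left h1 (hg w).le
      have h3 : g w * (w (Λ : K) * w (x : K)) ≤ ρ * lam * (g w₀ * j x) := by
        rw [mul_left_comm]
        exact mul_le_mul (hΛw w hw) (hx1 w hw) (mul_nonneg (hg w).le (apply_nonneg w _))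
          (by nlinarith)
      have h4 := hcw w hw
      have h5 : 3 * h ≤ lam * (1 - ρ) * (g w₀ * j x) := by nlinarith
      nlinarith
    have hz2 : h ≤ g w₀ * j (Λ * x - c : 𝓞 K) := by rw [hv]; nlinarith
    obtain ⟨m, hm, hm'⟩ := exists_multiset_sum_eq j w₀ hw₀ g hg hμ.le cov (z := Λ * x - c)
      (θ := (1 + ρ) / 2) (h := h) hz1 (by linarith) hz2 (by nlinarith)
    refine ⟨m, hm, fun y hy => ?_⟩
    obtain ⟨h1, h2, h3⟩ := hm' y hy
    exact ⟨h1, by linarith, by linarith⟩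
  choose! m hm hmT using hdec
  classical
  obtain ⟨n, hn, hle⟩ := exists_mem_primitiveDims_le_card hTfin.toFinset
    (fun x => g w₀ * j (x : K)) (fun x hx => by
      have := ((hTfin.mem_toFinset).1 hx).2.1
      linarith) (lam := lam) (by linarith) (fun x => c ::ₘ m x)
    (fun x hx y hy => by
      rw [Set.Finite.mem_toFinset] at hx ⊢
      rcases Multiset.mem_cons.1 hy with rfl | hy
      · exact hcT
      · exact hmT x hx y hy)
    (fun x hx => by
      rw [Set.Finite.mem_toFinset] at hx
      rw [← place_value_sum, Multiset.sum_cons, hm x hx, add_sub_cancel]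
      push_cast
      rw [map_mul, hΛ]; ring)
    c ((hTfin.mem_toFinset).2 hcT) 1 (fun x hx k hk => by
      have : ∀ k x, HasWalk (fun x => c ::ₘ m x) (k + 1) x c := by
        intro k
        induction k with
        | zero => exact fun x => .single (Multiset.mem_cons_self _ _)
        | succ k ih => exact fun x => ⟨c, Multiset.mem_cons_self _ _, ih c⟩
      obtain ⟨k, rfl⟩ := Nat.exists_eq_add_of_le' hk
      exact this k x)
  refine ⟨n, hn, hle.trans ?_⟩
  rw [← Set.ncard_eq_toFinset_card T hTfin]
  exact Set.ncard_le_ncard hTsub hfin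

/-- An integer dominating its conjugates at a real place is the spectral radius of some primitive
integral matrix. -/
theorem primitiveDims_nonempty_of_center (j : K →+* ℝ) (w₀ : InfinitePlace K)
    (hw₀ : ∀ x, w₀ x = |j x|) (g : InfinitePlace K → ℝ) (hg : ∀ w, 0 < g w) {μ : ℝ} (hμ : 0 < μ)
    (cov : ∀ x : K, ∃ y : 𝓞 K, ∀ w : InfinitePlace K, g w * w (x - y) ≤ μ)
    {Λ : 𝓞 K} {lam ρ : ℝ} (hΛ : j Λ = lam) (hρ0 : 0 ≤ ρ) (hρ : ρ < 1)
    (hΛw : ∀ w ≠ w₀, w (Λ : K) ≤ ρ * lam) (hlam : 1 < lam)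
    (hcenter : ∀ h : ℝ, ∃ y : 𝓞 K, |g w₀ * j y - h| ≤ μ ∧ ∀ w ≠ w₀, g w * w (y : K) ≤ μ) :
    (primitiveDims lam).Nonempty := by
  have hρ' : 0 < 1 - ρ := by linarith
  set h := 8 * μ / (1 - ρ) with hh
  have hh1 : h * (1 - ρ) = 8 * μ := by rw [hh]; field_simp
  have hh8 : 8 * μ ≤ h := by nlinarith
  obtain ⟨c, hc, hcw⟩ := hcenter h
  obtain ⟨hc1, hc2⟩ := abs_le.1 hc
  set C := g w₀ * j c with hC
  -- With no lower bound on `lam` beyond `1`, the height window is `(0, b]`: elements stay unsplit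
  -- under multiplication by `Λ` until the height would exceed `b`. This `b` is large enough that `c
  -- + Λ * c` can then be subtracted within the `(1 + ρ) / 2`-cone.
  obtain ⟨b, hb⟩ : ∃ b : ℝ, b * (1 - ρ) = 4 * ((1 + lam) * (C + μ)) :=
    ⟨4 * ((1 + lam) * (C + μ)) / (1 - ρ), by field_simp⟩
  have hb4 : 4 * ((1 + lam) * (C + μ)) ≤ b := by
    rw [← hb]
    have : 0 ≤ b := nonneg_of_mul_nonneg_left (b := 1 - ρ) (by rw [hb]; nlinarith) hρ'
    nlinarith
  have hCb : lam * C ≤ b := by nlinarith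
  set T : Set (𝓞 K) := {x | (∀ w ≠ w₀, g w * w (x : K) ≤ g w₀ * j x) ∧ 0 < g w₀ * j x ∧
    g w₀ * j x ≤ b} with hT
  have hTfin : T.Finite := by
    refine (finite_integers_place_le g hg b).subset ?_
    rintro x ⟨hx1, hx2, hx3⟩ w
    by_cases hw : w = w₀
    · rwa [hw, hw₀, abs_of_pos ((mul_pos_iff_of_pos_left (hg w₀)).1 hx2)]
    · exact (hx1 w hw).trans hx3
  have hcT : c ∈ T := ⟨fun w hw => (hcw w hw).trans (by linarith), by linarith, by nlinarith⟩
  have hvΛ : ∀ x : 𝓞 K, g w₀ * j (Λ * x : 𝓞 K) = lam * (g w₀ * j x) := fun x => by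
    push_cast
    rw [map_mul, hΛ]; ring
  have hΛT : ∀ x ∈ T, lam * (g w₀ * j x) ≤ b → Λ * x ∈ T := by
    rintro x ⟨hx1, hx2, hx3⟩ hx
    refine ⟨fun w hw => ?_, by rw [hvΛ]; nlinarith, by rwa [hvΛ]⟩
    rw [hvΛ]
    push_cast
    rw [map_mul, mul_left_comm]
    refine (mul_le_mul (hΛw w hw) (hx1 w hw) (mul_nonneg (hg w).le (apply_nonneg w _))
      (by nlinarith)).trans ?_
    have : 0 ≤ (1 - ρ) * (lam * (g w₀ * j x)) := by positivity
    linarith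
  have hdec : ∀ x ∈ T, b < lam * (g w₀ * j x) → ∃ m : Multiset (𝓞 K),
      m.sum = Λ * x - (c + Λ * c) ∧ ∀ y ∈ m, y ∈ T := by
    rintro x ⟨hx1, hx2, hx3⟩ hx
    have hv : g w₀ * j (Λ * x - (c + Λ * c) : 𝓞 K) = lam * (g w₀ * j x) - (1 + lam) * C := by
      push_cast
      rw [map_sub, map_add, map_mul, map_mul, hΛ]; ring
    have hz1 : ∀ w ≠ w₀, g w * w ((Λ * x - (c + Λ * c) : 𝓞 K) : K) ≤
        (1 + ρ) / 2 * (g w₀ * j (Λ * x - (c + Λ * c) : 𝓞 K)) := by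
      intro w hw
      rw [hv]
      have h1 : w ((Λ * x - (c + Λ * c) : 𝓞 K) : K) ≤
          w (Λ : K) * w (x : K) + (w (c : K) + w (Λ : K) * w (c : K)) := by
        push_cast
        rw [← map_mul w, ← map_mul w]
        exact (w.1.sub_le_add _ _).trans (add_le_add_right (w.1.add_le _ _) _)
      have h2 := mul_le_mul_of_nonneg_left h1 (hg w).le
      have h3 : g w * (w (Λ : K) * w (x : K)) ≤ ρ * lam * (g w₀ * j x) := by
        rw [mul_left_comm]
        exact mul_le_mul (hΛw w hw) (hx1 w hw) (mul_nonneg (hg w).le (apply_nonneg w _))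
          (by nlinarith)
      have h4 : g w * (w (Λ : K) * w (c : K)) ≤ lam * μ := by
        rw [mul_left_comm]
        refine mul_le_mul ((hΛw w hw).trans (by nlinarith)) (hcw w hw)
          (mul_nonneg (hg w).le (apply_nonneg w _)) (by linarith)
      have h5 := hcw w hw
      have h6 : 4 * ((1 + lam) * (C + μ)) ≤ lam * (g w₀ * j x) * (1 - ρ) := by
        rw [← hb]; exact mul_le_mul_of_nonneg_right hx.le hρ'.le
      have h7 : ρ * lam * (g w₀ * j x) + (1 + lam) * μ ≤
          (1 + ρ) / 2 * (lam * (g w₀ * j x)) - (1 + lam) * C := by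
        nlinarith
      have h8 : (1 + ρ) / 2 * ((1 + lam) * C) ≤ (1 + lam) * C := by
        have : 0 ≤ (1 + lam) * C := mul_nonneg (by linarith) (by linarith)
        nlinarith
      linarith
    have hz2 : h ≤ g w₀ * j (Λ * x - (c + Λ * c) : 𝓞 K) := by rw [hv]; nlinarith
    obtain ⟨m, hm, hm'⟩ := exists_multiset_sum_eq j w₀ hw₀ g hg hμ.le cov
      (z := Λ * x - (c + Λ * c)) (θ := (1 + ρ) / 2) (h := h) hz1 (by linarith) hz2 (by nlinarith)
    refine ⟨m, hm, fun y hy => ?_⟩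
    obtain ⟨h1, h2, h3⟩ := hm' y hy
    exact ⟨h1, by linarith, by nlinarith⟩
  choose! m' hm' hmT' using hdec
  classical
  let m : 𝓞 K → Multiset (𝓞 K) := fun x =>
    if lam * (g w₀ * j x) ≤ b then {Λ * x} else c ::ₘ (Λ * c) ::ₘ m' x
  have hm_le : ∀ x : 𝓞 K, lam * (g w₀ * j x) ≤ b → m x = {Λ * x} := fun x hx => if_pos hx
  have hm_gt : ∀ x : 𝓞 K, b < lam * (g w₀ * j x) → m x = c ::ₘ (Λ * c) ::ₘ m' x :=
    fun x hx => if_neg hx.not_ge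
  have hpow : ∀ i : ℕ, g w₀ * j (Λ ^ i * c : 𝓞 K) = lam ^ i * C := fun i => by
    push_cast
    rw [map_mul, map_pow, hΛ, hC]; ring
  have hCpos : 0 < C := by linarith
  have hex : ∃ k, b < lam ^ (k + 1) * C := by
    obtain ⟨k, hk⟩ := pow_unbounded_of_one_lt (b / C) hlam
    refine ⟨k, ?_⟩
    rw [div_lt_iff₀ hCpos] at hk
    refine hk.trans_le (mul_le_mul_of_nonneg_right ?_ hCpos.le)
    exact pow_le_pow_right₀ hlam.le (Nat.le_succ k)
  obtain ⟨k, hk, hkmin⟩ : ∃ k, b < lam ^ (k + 1) * C ∧ ∀ i < k, lam ^ (i + 1) * C ≤ b :=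
    ⟨Nat.find hex, Nat.find_spec hex, fun i hi => not_lt.1 (Nat.find_min hex hi)⟩
  have hk1 : 1 ≤ k := by
    by_contra! h0
    rw [Nat.lt_one_iff.1 h0, zero_add, pow_one] at hk
    linarith
  have hchain : ∀ l i, i + l ≤ k → HasWalk m l (Λ ^ i * c) (Λ ^ (i + l) * c) := by
    intro l
    induction l with
    | zero => exact fun i _ => rfl
    | succ l ih =>
      intro i hi
      refine ⟨Λ ^ (i + 1) * c, ?_, ?_⟩
      · rw [hm_le _ (by rw [hpow, ← mul_assoc, ← pow_succ']; exact hkmin i (by omega)),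
          Multiset.mem_singleton, pow_succ']
        ring
      · have := ih (i + 1) (by omega)
        rwa [show i + 1 + l = i + (l + 1) by omega] at this
  have htop : m (Λ ^ k * c) = c ::ₘ (Λ * c) ::ₘ m' (Λ ^ k * c) :=
    hm_gt _ (by rw [hpow, ← mul_assoc, ← pow_succ']; exact hk)
  have hck : HasWalk m k c (Λ ^ k * c) := by simpa using hchain k 0 (by omega)
  have hcyc1 : HasWalk m (k + 1) c c := hck.trans (.single (by rw [htop]; simp))
  -- Splitting off both `c` and `Λ * c` gives closed walks at `c` of coprime lengths `k + 1` and `2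
  -- * k + 1`, hence of every length from `k * (2 * k)` on.
  have hcyc2 : HasWalk m (2 * k + 1) c c := by
    have h1 : HasWalk m 1 (Λ ^ k * c) (Λ * c) := .single (by rw [htop]; simp)
    have h2 : HasWalk m (k - 1) (Λ * c) (Λ ^ k * c) := by
      simpa [Nat.add_sub_cancel' hk1] using hchain (k - 1) 1 (by omega)
    have h3 := ((hck.trans h1).trans h2).trans (.single (y := c) (by rw [htop]; simp))
    rwa [show k + 1 + (k - 1) + 1 = 2 * k + 1 by omega] at h3
  have hmul : ∀ p, HasWalk m p c c → ∀ a, HasWalk m (a * p) c c := by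
    intro p hp a
    induction a with
    | zero => rw [zero_mul]; rfl
    | succ a ih => rw [Nat.succ_mul]; exact ih.trans hp
  have hcyc : ∀ n, k * (2 * k) ≤ n → HasWalk m n c c := by
    intro n hn
    have hcop : (k + 1).gcd (2 * k + 1) = 1 := by
      have : Nat.Coprime (k + 1) (2 * k + 1) := by
        rw [show 2 * k + 1 = k + (k + 1) by omega, Nat.coprime_add_self_right]
        simp
      exact this
    obtain ⟨a, a', rfl⟩ := Nat.exists_add_mul_eq_of_gcd_dvd_of_mul_pred_le (k + 1) (2 * k + 1) n
      (by rw [hcop]; exact one_dvd n) hn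
    exact (hmul _ hcyc1 a).trans (hmul _ hcyc2 a')
  have hreach : ∀ i, ∀ x ∈ T, b < lam ^ (i + 1) * (g w₀ * j x) → ∃ e, HasWalk m e x c := by
    intro i
    induction i with
    | zero =>
      intro x _ hx
      rw [zero_add, pow_one] at hx
      exact ⟨1, .single (by rw [hm_gt x hx]; simp)⟩
    | succ i ih =>
      intro x hxT hx
      by_cases hxb : lam * (g w₀ * j x) ≤ b
      · obtain ⟨e, he⟩ := ih (Λ * x) (hΛT x hxT hxb)
          (by rwa [hvΛ, ← mul_assoc, ← pow_succ])
        exact ⟨e + 1, Λ * x, by rw [hm_le x hxb]; simp, he⟩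
      · exact ⟨1, .single (by rw [hm_gt x (not_le.1 hxb)]; simp)⟩
  have hreach' : ∀ x ∈ T, ∃ e, HasWalk m e x c := by
    intro x hx
    obtain ⟨i, hi⟩ := pow_unbounded_of_one_lt (b / (g w₀ * j x)) hlam
    refine hreach i x hx ?_
    rw [div_lt_iff₀ hx.2.1] at hi
    refine hi.trans_le (mul_le_mul_of_nonneg_right ?_ hx.2.1.le)
    exact pow_le_pow_right₀ hlam.le (Nat.le_succ i)
  choose! e he using hreach'
  obtain ⟨n, hn, -⟩ := exists_mem_primitiveDims_le_card hTfin.toFinset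
    (fun x => g w₀ * j (x : K)) (fun x hx => ((hTfin.mem_toFinset).1 hx).2.1) (lam := lam)
    (by linarith) m
    (fun x hx y hy => by
      rw [Set.Finite.mem_toFinset] at hx ⊢
      by_cases hxb : lam * (g w₀ * j x) ≤ b
      · rw [hm_le x hxb, Multiset.mem_singleton] at hy
        exact hy ▸ hΛT x hx hxb
      · rw [hm_gt x (not_le.1 hxb), Multiset.mem_cons, Multiset.mem_cons] at hy
        rcases hy with rfl | rfl | hy
        · exact hcT
        · exact hΛT c hcT hCb
        · exact hmT' x hx (not_le.1 hxb) y hy)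
    (fun x hx => by
      rw [Set.Finite.mem_toFinset] at hx
      rw [← place_value_sum, ← hvΛ]
      congr 3
      by_cases hxb : lam * (g w₀ * j x) ≤ b
      · rw [hm_le x hxb, Multiset.sum_singleton]
      · rw [hm_gt x (not_le.1 hxb), Multiset.sum_cons, Multiset.sum_cons,
          hm' x hx (not_le.1 hxb)]
        ring)
    c ((hTfin.mem_toFinset).2 hcT) (hTfin.toFinset.sup e + k * (2 * k)) (fun x hx n hn => by
      have h1 : e x ≤ hTfin.toFinset.sup e := Finset.le_sup hx
      have h2 := (he x ((hTfin.mem_toFinset).1 hx)).trans (hcyc (n - e x) (by omega))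
      rwa [Nat.add_sub_cancel' (by omega)] at h2)
  exact ⟨n, hn⟩

end Decomposition

/-! ### Counting integers by covering arguments -/

section Counting

open MeasureTheory mixedEmbedding
open scoped Pointwise

variable {K : Type*} [Field K]

theorem mem_convexBodyLT_iff (f : InfinitePlace K → NNReal) (x : mixedSpace K) :
    x ∈ convexBodyLT K f ↔ ∀ w, normAtPlace w x < f w := by
  simp only [Set.mem_prod, Set.mem_pi, Set.mem_univ, mem_ball_zero_iff, forall_true_left]
  constructor
  · rintro ⟨h1, h2⟩ w
    rcases isReal_or_isComplex w with hw | hw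
    · rw [normAtPlace_apply_of_isReal hw]; exact h1 ⟨w, hw⟩
    · rw [normAtPlace_apply_of_isComplex hw]; exact h2 ⟨w, hw⟩
  · refine fun h => ⟨fun w => ?_, fun w => ?_⟩
    · rw [← normAtPlace_apply_of_isReal w.2]; exact h w
    · rw [← normAtPlace_apply_of_isComplex w.2]; exact h w

/-- Round the point with coordinate `h / g w₀` at `w₀` and `0` at all other places. -/
theorem exists_integer_near_real_axis (j : K →+* ℝ) (w₀ : InfinitePlace K) (hreal : IsReal w₀)
    (hj : ∀ x, embedding_of_isReal hreal x = j x)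
    (g : InfinitePlace K → ℝ) (hg : ∀ w, 0 < g w) {μ : ℝ}
    (cov : ∀ x : mixedSpace K, ∃ y : 𝓞 K, ∀ w,
      g w * normAtPlace w (x - mixedEmbedding K y) ≤ μ) (h : ℝ) :
    ∃ y : 𝓞 K, |g w₀ * j y - h| ≤ μ ∧ ∀ w ≠ w₀, g w * w (y : K) ≤ μ := by
  classical
  obtain ⟨y, hy⟩ := cov (Pi.single ⟨w₀, hreal⟩ (h / g w₀), 0)
  refine ⟨y, ?_, fun w hw => ?_⟩
  · have := hy w₀
    rw [normAtPlace_apply_of_isReal hreal] at this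
    simp only [Prod.fst_sub, Pi.sub_apply, Pi.single_eq_same, mixedEmbedding_apply_isReal, hj,
      Real.norm_eq_abs] at this
    rw [abs_sub_comm]
    rw [← abs_of_pos (hg w₀), ← abs_mul, abs_of_pos (hg w₀), mul_sub,
      mul_div_cancel₀ _ (hg w₀).ne'] at this
    exact this
  · refine le_trans (le_of_eq ?_) (hy w)
    congr 1
    rw [← normAtPlace_apply, ← normAtPlace_neg, ← normAtPlace_neg w (_ - _)]
    rcases isReal_or_isComplex w with hwr | hwc
    · rw [normAtPlace_apply_of_isReal hwr, normAtPlace_apply_of_isReal hwr]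
      have : (⟨w, hwr⟩ : {w : InfinitePlace K // IsReal w}) ≠ ⟨w₀, hreal⟩ := fun h => hw
        (congrArg Subtype.val h)
      simp [this]
    · rw [normAtPlace_apply_of_isComplex hwc, normAtPlace_apply_of_isComplex hwc]
      simp

variable [NumberField K]

open Classical in
/-- The number of integers in a box, compared with the volume of a slightly larger box. -/
theorem ncard_integers_place_le (g : InfinitePlace K → ℝ) (hg : ∀ w, 0 < g w) {μ c c' : ℝ}
    (hc' : c + μ < c')
    (cov : ∀ x : mixedSpace K, ∃ y : 𝓞 K, ∀ w,
      g w * normAtPlace w (x - mixedEmbedding K y) ≤ μ) :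
    ({x : 𝓞 K | ∀ w : InfinitePlace K, g w * w (x : K) ≤ c}.ncard : ENNReal) *
      ((2 : ENNReal)⁻¹ ^ nrComplexPlaces K * NNReal.sqrt ‖discr K‖₊) ≤
      convexBodyLTFactor K * ∏ w : InfinitePlace K, ((c' / g w).toNNReal : ENNReal) ^ mult w := by
  set f : InfinitePlace K → NNReal := fun w => (c' / g w).toNNReal with hf
  set Z := {x : 𝓞 K | ∀ w : InfinitePlace K, g w * w (x : K) ≤ c} with hZ
  have hZfin : Z.Finite := finite_integers_place_le g hg c
  set F := ZSpan.fundamentalDomain (latticeBasis K) with hF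
  have hFD := fundamentalDomain_integerLattice K
  rw [← volume_fundamentalDomain_latticeBasis]
  have e := convexBodyLT_volume K f
  push_cast at e ⊢
  have : VAddInvariantMeasure (mixedEmbedding.integerLattice K) (mixedSpace K) volume :=
    ⟨fun a s _ => measure_preimage_add volume (a : mixedSpace K) s⟩
  have : MeasurableConstVAdd (mixedEmbedding.integerLattice K) (mixedSpace K) :=
    ⟨fun a => measurable_const_add (a : mixedSpace K)⟩
  -- Unfolding: the volume of the box is the integral over the fundamental domain of the number of
  -- its lattice translates containing `x`. It remains to find `Z.ncard` such translates for every
  -- `x`.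
  rw [← e, hFD.measure_eq_tsum (convexBodyLT K f)]
  have hmeas : ∀ a : mixedEmbedding.integerLattice K, MeasurableSet (a +ᵥ convexBodyLT K f) := by
    intro a
    refine MeasurableSet.const_vadd ?_ a
    exact (MeasurableSet.univ_pi fun w => measurableSet_ball).prod
      (MeasurableSet.univ_pi fun w => measurableSet_ball)
  have e2 : ∀ a : mixedEmbedding.integerLattice K, volume ((a +ᵥ convexBodyLT K f) ∩ F) =
      ∫⁻ x in F, (a +ᵥ convexBodyLT K f).indicator 1 x := by
    intro a
    rw [lintegral_indicator_one (hmeas a), Measure.restrict_apply (hmeas a)]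
  rw [tsum_congr e2, ← lintegral_tsum fun a => (measurable_one.indicator (hmeas a)).aemeasurable,
    ← setLIntegral_const]
  refine lintegral_mono fun x => ?_
  -- With `y` near `x`, every `z ∈ Z` supplies the translate by `y - z`: the point `x - y + z` has
  -- weighted size at most `μ + c < c'`.
  obtain ⟨y, hy⟩ := cov x
  let ι : 𝓞 K → mixedEmbedding.integerLattice K := fun z =>
    ⟨mixedEmbedding K (z : K), ⟨z, by simp⟩⟩
  have hι : Function.Injective ι := fun a b hab => RingOfIntegers.coe_injective
    (mixedEmbedding_injective K (congrArg Subtype.val hab))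
  have hinj : Function.Injective fun z : 𝓞 K => ι y - ι z := fun a b hab =>
    hι (sub_right_injective hab)
  calc (Z.ncard : ENNReal)
      = ∑ a ∈ hZfin.toFinset.image (fun z => ι y - ι z),
          (a +ᵥ convexBodyLT K f).indicator (1 : mixedSpace K → ENNReal) x := by
        rw [Finset.sum_image hinj.injOn, Set.ncard_eq_toFinset_card Z hZfin,
          Finset.card_eq_sum_ones, Nat.cast_sum]
        refine Finset.sum_congr rfl fun z hz => ?_
        rw [Set.indicator_of_mem, Pi.one_apply, Nat.cast_one]
        rw [Set.mem_vadd_set_iff_neg_vadd_mem, mem_convexBodyLT_iff]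
        intro w
        have hz' : g w * w (z : K) ≤ c := (hZfin.mem_toFinset.1 hz) w
        have e3 : -(ι y - ι z) +ᵥ x = (x - mixedEmbedding K y) + mixedEmbedding K z := by
          rw [Submodule.vadd_def]
          simp only [ι, vadd_eq_add]
          push_cast
          abel
        have e4 := mul_le_mul_of_nonneg_left
          (normAtPlace_add_le w (x - mixedEmbedding K y) (mixedEmbedding K (z : K))) (hg w).le
        have e5 := hy w
        rw [normAtPlace_apply, mul_add] at e4
        rw [e3]
        refine lt_of_lt_of_le ?_ (Real.le_coe_toNNReal _)
        rw [lt_div_iff₀ (hg w)]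
        linarith
    _ ≤ _ := ENNReal.sum_le_tsum _

open Classical in
theorem exists_norm_sub_mixedEmbedding_le :
    ∃ M : ℝ, ∀ x : mixedSpace K, ∃ y : 𝓞 K, ‖x - mixedEmbedding K y‖ ≤ M := by
  refine ⟨∑ i, ‖latticeBasis K i‖, fun x => ?_⟩
  obtain ⟨y, hy⟩ := (mem_span_latticeBasis K).1 (ZSpan.floor (latticeBasis K) x).2
  refine ⟨y, ?_⟩
  have : mixedEmbedding K (y : K) = (ZSpan.floor (latticeBasis K) x : mixedSpace K) := hy
  rw [this, ← ZSpan.fract_apply]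
  exact ZSpan.norm_fract_le _ _

end Counting

/-! ### The lattice of integers with the form `q_α` -/

section Lattice

open mixedEmbedding

variable {K : Type*} [Field K] [NumberField K]

open Classical in
theorem sum_eq_sum_isReal_add_sum_isComplex (f : InfinitePlace K → ℝ) :
    ∑ w, f w = (∑ w : {w : InfinitePlace K // IsReal w}, f w.1) +
      ∑ w : {w : InfinitePlace K // IsComplex w}, f w.1 := by
  have := prod_eq_prod_mul_prod (K := K) fun w => Multiplicative.ofAdd (f w)
  exact this

theorem qForm_self (α : InfinitePlace K → ℝ) (x : mixedSpace K) :
    qForm K α x x = ∑ w, mult w * α w * normAtPlace w x ^ 2 := by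
  classical
  rw [sum_eq_sum_isReal_add_sum_isComplex, qForm]
  congr 1
  · refine Finset.sum_congr (by congr!) fun w _ => ?_
    rw [normAtPlace_apply_of_isReal w.2, mult_isReal, Real.norm_eq_abs, sq_abs]
    push_cast; ring
  · refine Finset.sum_congr (by congr!) fun w _ => ?_
    rw [normAtPlace_apply_of_isComplex w.2, mult_isComplex, mul_assoc, Complex.mul_conj,
      Complex.normSq_eq_norm_sq, Complex.re_ofReal_mul, Complex.ofReal_re]
    push_cast; ring

/-- Over all complex embeddings the form becomes a diagonal Hermitian one: a conjugate pair
contributes a number plus its conjugate, which is the `2 Re` term. -/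
theorem qForm_mixedEmbedding (α : InfinitePlace K → ℝ) (x y : K) :
    (qForm K α (mixedEmbedding K x) (mixedEmbedding K y) : ℂ) =
      ∑ φ : K →+* ℂ, α (mk φ) * φ x * (starRingEnd ℂ) (φ y) := by
  classical
  rw [← (indexEquiv K).sum_comp, Fintype.sum_sum_type, qForm]
  push_cast
  congr 1
  · refine Finset.sum_congr (by congr!) fun w _ => ?_
    rw [indexEquiv_apply_isReal, mk_embedding, mixedEmbedding_apply_isReal,
      mixedEmbedding_apply_isReal, embedding_of_isReal_apply, ← embedding_of_isReal_apply w.2 y,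
      Complex.conj_ofReal]
  · rw [Fintype.sum_prod_type]
    refine Finset.sum_congr (by congr!) fun w _ => ?_
    rw [Fin.sum_univ_two, indexEquiv_apply_isComplex_fst, indexEquiv_apply_isComplex_snd,
      mk_conjugate_eq, mk_embedding, mixedEmbedding_apply_isComplex,
      mixedEmbedding_apply_isComplex]
    simp only [ComplexEmbedding.conjugate_coe_eq, Complex.conj_conj]
    set z := (α w.1 : ℂ) * (w.1.embedding x) * (starRingEnd ℂ) (w.1.embedding y) with hz
    have : (α w.1 : ℂ) * (starRingEnd ℂ) (w.1.embedding x) * w.1.embedding y =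
        (starRingEnd ℂ) z := by
      rw [hz]; simp
    rw [this, Complex.add_conj]
    push_cast; ring

theorem prod_embeddings_eq_prod_places (f : InfinitePlace K → ℂ) :
    ∏ φ : K →+* ℂ, f (mk φ) = ∏ w, f w ^ mult w := by
  classical
  rw [← Finset.prod_fiberwise Finset.univ mk]
  refine Finset.prod_congr rfl fun w _ => ?_
  rw [Finset.prod_congr rfl fun φ hφ => by rw [(Finset.mem_filter.1 hφ).2], Finset.prod_const,
    card_filter_mk_eq]

/-- The Gram matrix is `M * diag(α) * Mᴴ` with `M` the matrix of embeddings of an integral basis,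
and `|det M| ^ 2 = |D_K|`. -/
theorem latticeDet_eq (α : InfinitePlace K → ℝ) :
    latticeDet K α = (∏ w, α w ^ mult w) * |(discr K : ℝ)| := by
  classical
  let e : Module.Free.ChooseBasisIndex ℤ (𝓞 K) ≃ (K →+* ℂ) :=
    (canonicalEmbedding.latticeBasis K).indexEquiv (Pi.basisFun ℂ _)
  let M : Matrix (Module.Free.ChooseBasisIndex ℤ (𝓞 K)) (Module.Free.ChooseBasisIndex ℤ (𝓞 K)) ℂ :=
    Algebra.embeddingsMatrixReindex ℚ ℂ (integralBasis K) (e.trans (RingHom.equivRatAlgHom K ℂ))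
  have hM : ∀ i k, M i k = e k (RingOfIntegers.basis K i : K) := by
    intro i k
    simp [M, Algebra.embeddingsMatrixReindex, Algebra.embeddingsMatrix_apply]
  have hdisc : M.det ^ 2 = (discr K : ℂ) := by
    rw [← Algebra.discr_eq_det_embeddingsMatrixReindex_pow_two, ← coe_discr]
    simp
  have hgram : ((Matrix.of fun i j => qForm K α (mixedEmbedding K (RingOfIntegers.basis K i))
      (mixedEmbedding K (RingOfIntegers.basis K j))).map Complex.ofRealHom) =
      M * Matrix.diagonal (fun k => (α (mk (e k)) : ℂ)) * M.conjTranspose := by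
    ext i j
    rw [Matrix.map_apply, Matrix.of_apply, Matrix.mul_apply, Complex.ofRealHom_eq_coe,
      qForm_mixedEmbedding, ← e.sum_comp]
    refine Finset.sum_congr rfl fun k _ => ?_
    rw [Matrix.mul_diagonal, Matrix.conjTranspose_apply, hM, hM]
    simp only [RCLike.star_def]
    ring
  have hdet : (latticeDet K α : ℂ) = M.det * (∏ w, (α w : ℂ) ^ mult w) * star M.det := by
    rw [← prod_embeddings_eq_prod_places (fun w => (α w : ℂ)), ← e.prod_comp,
      ← Matrix.det_diagonal, ← Matrix.det_conjTranspose, ← Matrix.det_mul, ← Matrix.det_mul,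
      ← hgram, latticeDet, ← Complex.ofRealHom_eq_coe, RingHom.map_det]
    congr!
  have h2 : M.det * star M.det = ((|(discr K : ℝ)| : ℝ) : ℂ) := by
    rw [RCLike.star_def, Complex.mul_conj, Complex.normSq_eq_norm_sq, ← norm_pow, hdisc,
      Complex.norm_intCast]
  apply Complex.ofReal_injective
  rw [hdet, mul_right_comm, h2]
  push_cast; ring

theorem latticeDet_pos (α : InfinitePlace K → ℝ) (hα : ∀ w, 0 < α w) : 0 < latticeDet K α := by
  rw [latticeDet_eq]
  exact mul_pos (Finset.prod_pos fun w _ => pow_pos (hα w) _)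
    (abs_pos.2 (Int.cast_ne_zero.2 (discr_ne_zero K)))

theorem qForm_self_nonneg (α : InfinitePlace K → ℝ) (hα : ∀ w, 0 < α w) (x : mixedSpace K) :
    0 ≤ qForm K α x x := by
  rw [qForm_self]
  exact Finset.sum_nonneg fun w _ => by have := hα w; positivity

theorem latticeMax_nonneg (α : InfinitePlace K → ℝ) (hα : ∀ w, 0 < α w) : 0 ≤ latticeMax K α := by
  refine Real.sInf_nonneg fun u hu => ?_
  obtain ⟨y, hy⟩ := hu 0
  exact (qForm_self_nonneg α hα _).trans hy

/-- Ensures that the infimum in `latticeMax` is over a nonempty set, not the default value `0`. -/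
theorem exists_qForm_le (α : InfinitePlace K → ℝ) (hα : ∀ w, 0 < α w) :
    ∃ u : ℝ, ∀ x : mixedSpace K, ∃ y : 𝓞 K,
      qForm K α (x - mixedEmbedding K y) (x - mixedEmbedding K y) ≤ u := by
  classical
  obtain ⟨M, hM⟩ := exists_norm_sub_mixedEmbedding_le (K := K)
  refine ⟨∑ w, mult w * α w * M ^ 2, fun x => ?_⟩
  obtain ⟨y, hy⟩ := hM x
  refine ⟨y, ?_⟩
  rw [qForm_self]
  refine Finset.sum_le_sum fun w _ => ?_
  have := hα w
  refine mul_le_mul_of_nonneg_left ?_ (by positivity)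
  refine pow_le_pow_left₀ (normAtPlace_nonneg _ _) (le_trans ?_ hy) 2
  rw [norm_eq_sup'_normAtPlace]
  exact Finset.le_sup' (fun w => normAtPlace w (x - mixedEmbedding K (y : K))) (Finset.mem_univ w)

/-- Each term of `q_α` is at most the whole sum. The strict inequality avoids asking whether the
infimum is attained. -/
theorem exists_normAtPlace_le_of_latticeMax_lt (α : InfinitePlace K → ℝ) (hα : ∀ w, 0 < α w)
    {u : ℝ} (hu : latticeMax K α < u) (x : mixedSpace K) :
    ∃ y : 𝓞 K, ∀ w, √(α w) * normAtPlace w (x - mixedEmbedding K y) ≤ √u := by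
  obtain ⟨u', hu', hlt⟩ := exists_lt_of_csInf_lt (exists_qForm_le α hα) hu
  obtain ⟨y, hy⟩ := hu' x
  refine ⟨y, fun w => Real.le_sqrt_of_sq_le ?_⟩
  rw [mul_pow, Real.sq_sqrt (hα w).le]
  refine le_trans ?_ (hy.trans hlt.le)
  rw [qForm_self]
  refine le_trans ?_ (Finset.single_le_sum (f := fun w => mult w * α w *
    normAtPlace w (x - mixedEmbedding K (y : K)) ^ 2) (fun w _ => by
      have := hα w; positivity) (Finset.mem_univ w))
  have h1 : (1 : ℝ) ≤ mult w := by exact_mod_cast mult_pos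
  have h2 := mul_nonneg (hα w).le (sq_nonneg (normAtPlace w (x - mixedEmbedding K (y : K))))
  nlinarith

end Lattice

/-! ### Bounding the degree by the minimal thickness -/

section Bound

open mixedEmbedding

variable {K : Type*} [Field K] [NumberField K]

theorem ncard_integers_sqrt_le (α : InfinitePlace K → ℝ) (hα : ∀ w, 0 < α w) {μ c c' : ℝ}
    (hc0 : 0 ≤ c') (hc' : c + μ < c')
    (cov : ∀ x : mixedSpace K, ∃ y : 𝓞 K, ∀ w,
      √(α w) * normAtPlace w (x - mixedEmbedding K y) ≤ μ) :
    ({x : 𝓞 K | ∀ w : InfinitePlace K, √(α w) * w (x : K) ≤ c}.ncard : ℝ) * √(latticeDet K α) ≤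
      (3 * c') ^ Module.finrank ℚ K := by
  classical
  have hg : ∀ w, 0 < √(α w) := fun w => Real.sqrt_pos.2 (hα w)
  have h := ncard_integers_place_le (fun w => √(α w)) hg hc' cov
  set N := {x : 𝓞 K | ∀ w : InfinitePlace K, √(α w) * w (x : K) ≤ c}.ncard
  have h1 := ENNReal.toReal_mono (ENNReal.mul_ne_top ENNReal.coe_ne_top
    (ENNReal.prod_ne_top fun w _ => by finiteness)) h
  simp only [ENNReal.toReal_mul, ENNReal.toReal_pow, ENNReal.toReal_prod, ENNReal.toReal_inv,
    ENNReal.toReal_natCast, ENNReal.coe_toReal, ENNReal.toReal_ofNat, Real.coe_sqrt, coe_nnnorm,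
    Int.norm_eq_abs, Real.coe_toNNReal _ (div_nonneg hc0 (hg _).le), NNReal.coe_mul,
    NNReal.coe_pow, NNReal.coe_ofNat, NNReal.coe_real_pi] at h1
  set P := ∏ w : InfinitePlace K, √(α w) ^ mult w with hP
  have hP0 : 0 < P := Finset.prod_pos fun w _ => pow_pos (hg w) _
  have hdet : √(latticeDet K α) = P * √|(discr K : ℝ)| := by
    rw [latticeDet_eq, Real.sqrt_mul (Finset.prod_nonneg fun w _ => pow_nonneg (hα w).le _)]
    congr 1
    rw [Real.sqrt_eq_iff_mul_self_eq (Finset.prod_nonneg fun w _ => pow_nonneg (hα w).le _) hP0.le,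
      hP, ← Finset.prod_mul_distrib]
    refine Finset.prod_congr rfl fun w _ => ?_
    rw [← mul_pow, Real.mul_self_sqrt (hα w).le]
  have hprod : ∏ w : InfinitePlace K, (c' / √(α w)) ^ mult w = c' ^ Module.finrank ℚ K / P := by
    simp_rw [div_pow]
    rw [Finset.prod_div_distrib, Finset.prod_pow_eq_pow_sum, sum_mult_eq]
  rw [hprod] at h1
  have h2 : (N : ℝ) * √|(discr K : ℝ)| * P ≤
      2 ^ nrRealPlaces K * (2 * Real.pi) ^ nrComplexPlaces K * c' ^ Module.finrank ℚ K := by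
    have h3 := mul_le_mul_of_nonneg_right h1
      (mul_nonneg (pow_nonneg zero_le_two (nrComplexPlaces K)) hP0.le)
    have e1 : (N : ℝ) * (2⁻¹ ^ nrComplexPlaces K * √|(discr K : ℝ)|) *
        (2 ^ nrComplexPlaces K * P) = N * √|(discr K : ℝ)| * P := by
      rw [inv_pow]; field_simp
    rw [e1] at h3
    refine h3.trans (le_of_eq ?_)
    rw [mul_pow]
    field_simp
  -- Real places give `2 ≤ 3`, complex ones `2π ≤ 3 ^ 2`.
  have h4 : (2 : ℝ) ^ nrRealPlaces K * (2 * Real.pi) ^ nrComplexPlaces K ≤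
      3 ^ Module.finrank ℚ K := by
    rw [← card_add_two_mul_card_eq_rank K, pow_add, pow_mul]
    refine mul_le_mul (pow_le_pow_left₀ zero_le_two (by norm_num) _)
      (pow_le_pow_left₀ (by positivity) ?_ _) (by positivity) (by positivity)
    nlinarith [Real.pi_lt_d2]
  rw [hdet, mul_pow]
  calc (N : ℝ) * (P * √|(discr K : ℝ)|) = N * √|(discr K : ℝ)| * P := by ring
    _ ≤ _ := h2
    _ ≤ _ := mul_le_mul_of_nonneg_right h4 (pow_nonneg hc0 _)

theorem exists_lt_thickness {t : ℝ} (ht : tauMin K < t) :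
    ∃ α : InfinitePlace K → ℝ, (∀ w, 0 < α w) ∧ thickness K α < t := by
  obtain ⟨_, ⟨α, hα, rfl⟩, h⟩ := exists_lt_of_csInf_lt
    (s := {t : ℝ | ∃ α : InfinitePlace K → ℝ, (∀ w, 0 < α w) ∧ t = thickness K α})
    ⟨_, fun _ => 1, fun _ => one_pos, rfl⟩ ht
  exact ⟨α, hα, h⟩

theorem thickness_nonneg (α : InfinitePlace K → ℝ) (hα : ∀ w, 0 < α w) : 0 ≤ thickness K α :=
  div_nonneg (latticeMax_nonneg α hα) (Real.rpow_nonneg (latticeDet_pos α hα).le _)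

theorem tauMin_nonneg : 0 ≤ tauMin K := by
  refine Real.sInf_nonneg ?_
  rintro _ ⟨α, hα, rfl⟩
  exact thickness_nonneg α hα

variable (j : K →+* ℝ) (w₀ : InfinitePlace K) (hreal : IsReal w₀)
  (hj : ∀ x, embedding_of_isReal hreal x = j x) {Λ : 𝓞 K} {lam ρ : ℝ} (hΛ : j Λ = lam)
  (hρ0 : 0 ≤ ρ) (hρ : ρ < 1) (hΛw : ∀ w ≠ w₀, w (Λ : K) ≤ ρ * lam)

include hj hΛ hρ0 hρ hΛw

/-- Lind's theorem. -/
theorem primitiveDims_nonempty (hlam : 1 < lam) : (primitiveDims lam).Nonempty := by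
  have hw₀ : ∀ x, w₀ x = |j x| := fun x => by
    rw [← hj, ← Real.norm_eq_abs, norm_embedding_of_isReal]
  have hα : ∀ w : InfinitePlace K, (0 : ℝ) < (fun _ => 1) w := fun _ => one_pos
  have hM := latticeMax_nonneg (K := K) _ hα
  have cov := exists_normAtPlace_le_of_latticeMax_lt (fun _ => 1) hα
    (lt_add_one (latticeMax K fun _ => 1))
  refine primitiveDims_nonempty_of_center j w₀ hw₀ (fun _ => √1) (fun _ => by simp)
    (Real.sqrt_pos.2 (by linarith)) (fun x => ?_) hΛ hρ0 hρ hΛw hlam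
    (exists_integer_near_real_axis j w₀ hreal hj _ (fun _ => by simp) cov)
  obtain ⟨y, hy⟩ := cov (mixedEmbedding K x)
  refine ⟨y, fun w => ?_⟩
  have := hy w
  rwa [← map_sub, normAtPlace_apply] at this

/-- With `μ = √u` and `u = t * D ^ (1 / d)` one has `μ ^ d = t ^ (d / 2) * √D`, so `√D` cancels from
the count of integers in the box. -/
theorem exists_primitiveDims_le_of_tauMin_lt (hlarge : 1 + 4 / (1 - ρ) < lam) {t : ℝ}
    (ht : tauMin K < t) :
    ∃ n ∈ primitiveDims lam, (n : ℝ) ≤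
      (60 / (1 - ρ)) ^ Module.finrank ℚ K * t ^ ((Module.finrank ℚ K : ℝ) / 2) := by
  have hρ' : 0 < 1 - ρ := by linarith
  have hw₀ : ∀ x, w₀ x = |j x| := fun x => by
    rw [← hj, ← Real.norm_eq_abs, norm_embedding_of_isReal]
  obtain ⟨α, hα, hαt⟩ := exists_lt_thickness ht
  have ht0 : 0 < t := (thickness_nonneg α hα).trans_lt hαt
  have hdet := latticeDet_pos α hα
  set d := Module.finrank ℚ K with hd
  have hd0 : (d : ℝ) ≠ 0 := by
    have : d ≠ 0 := Module.finrank_pos.ne'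
    exact_mod_cast this
  set D := latticeDet K α
  set u := t * D ^ (1 / (d : ℝ)) with hu
  have hu0 : 0 < u := mul_pos ht0 (Real.rpow_pos_of_pos hdet _)
  have hmax : latticeMax K α < u := by
    rwa [thickness, div_lt_iff₀ (Real.rpow_pos_of_pos hdet _)] at hαt
  have cov := exists_normAtPlace_le_of_latticeMax_lt α hα hmax
  have hμ : 0 < √u := Real.sqrt_pos.2 hu0
  obtain ⟨n, hn, hle⟩ := exists_primitiveDims_le_of_large j w₀ hw₀ (fun w => √(α w))
    (fun w => Real.sqrt_pos.2 (hα w)) hμ (fun x => by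
      obtain ⟨y, hy⟩ := cov (mixedEmbedding K x)
      refine ⟨y, fun w => ?_⟩
      have := hy w
      rwa [← map_sub, normAtPlace_apply] at this) hΛ hρ0 hρ hΛw hlarge
    (exists_integer_near_real_axis j w₀ hreal hj _ (fun w => Real.sqrt_pos.2 (hα w)) cov)
  refine ⟨n, hn, ?_⟩
  -- Since `1 ≤ 1 / (1 - ρ)`, the constant `20` leaves room for `18 * μ / (1 - ρ)` plus `μ`; then
  -- `60 = 3 * 20`.
  have hcount := ncard_integers_sqrt_le α hα (c := 18 * √u / (1 - ρ)) (c' := 20 * √u / (1 - ρ))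
    (by positivity) (by
      have : √u ≤ √u / (1 - ρ) := by rw [le_div_iff₀ hρ']; nlinarith
      have e : 20 * √u / (1 - ρ) = 18 * √u / (1 - ρ) + 2 * (√u / (1 - ρ)) := by ring
      rw [e]
      have : 0 < √u / (1 - ρ) := by positivity
      linarith) cov
  have hle' := mul_le_mul_of_nonneg_right (show (n : ℝ) ≤ _ from Nat.cast_le.2 hle)
    (Real.sqrt_nonneg D)
  have hfin := hle'.trans hcount
  have e1 : (3 * (20 * √u / (1 - ρ))) ^ d =
      (60 / (1 - ρ)) ^ d * t ^ ((d : ℝ) / 2) * √D := by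
    have e2 : √u ^ d = t ^ ((d : ℝ) / 2) * √D := by
      rw [Real.sqrt_eq_rpow, Real.sqrt_eq_rpow, ← Real.rpow_natCast, ← Real.rpow_mul hu0.le, hu,
        Real.mul_rpow ht0.le (Real.rpow_nonneg hdet.le _), ← Real.rpow_mul hdet.le]
      congr 2 <;> field_simp
    rw [mul_assoc, ← e2, ← mul_pow]
    ring
  rw [← hd, e1] at hfin
  exact le_of_mul_le_mul_right hfin (Real.sqrt_pos.2 hdet)

/-- Let `t` decrease to `tauMin K`; no minimising `α` is needed. -/
theorem dPF_le_of_large (hlarge : 1 + 4 / (1 - ρ) < lam) :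
    (dPF lam : ℝ) ≤
      (60 / (1 - ρ)) ^ Module.finrank ℚ K * tauMin K ^ ((Module.finrank ℚ K : ℝ) / 2) := by
  set d := Module.finrank ℚ K
  have hcont : Continuous fun t : ℝ => (60 / (1 - ρ)) ^ d * t ^ ((d : ℝ) / 2) :=
    continuous_const.mul (Real.continuous_rpow_const (by positivity))
  refine ge_of_tendsto (hcont.continuousWithinAt (s := Set.Ioi (tauMin K)) (x := tauMin K)) ?_
  filter_upwards [self_mem_nhdsWithin] with t ht
  obtain ⟨n, hn, hle⟩ := exists_primitiveDims_le_of_tauMin_lt j w₀ hreal hj hΛ hρ0 hρ hΛw hlarge ht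
  exact le_trans (Nat.cast_le.2 (Nat.sInf_le hn)) hle

end Bound

/-! ### A transference bound for the covering radius -/

section Transference

open Module InnerProductSpace

variable {E : Type*} [NormedAddCommGroup E] [InnerProductSpace ℝ E]

/-- `v` pairs integrally with the lattice `L`. -/
def IsDualVector (L : Submodule ℤ E) (v : E) : Prop := ∀ x ∈ L, ∃ k : ℤ, inner ℝ v x = k

theorem exists_isDualVector_ne_zero [FiniteDimensional ℝ E] [Nontrivial E] (L : Submodule ℤ E)
    [DiscreteTopology L] [IsZLattice ℝ L] : ∃ v, v ≠ 0 ∧ IsDualVector L v := by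
  have := ZLattice.module_free ℝ L
  have := ZLattice.module_finite ℝ L
  let b := Free.chooseBasis ℤ L
  let B := b.ofZLatticeBasis ℝ L
  obtain ⟨i⟩ : Nonempty (Free.ChooseBasisIndex ℤ L) := by
    by_contra h
    rw [not_nonempty_iff] at h
    have := B.index_nonempty
    exact not_isEmpty_of_nonempty _ h
  let v := (toDual ℝ E).symm (LinearMap.toContinuousLinearMap (B.coord i))
  have hv : ∀ x, inner ℝ v x = B.repr x i := fun x => by
    simp [v, toDual_symm_apply]
  refine ⟨v, fun h0 => ?_, fun x hx => ⟨b.repr ⟨x, hx⟩ i, ?_⟩⟩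
  · have := hv (B i)
    rw [h0, inner_zero_left] at this
    simp at this
  · rw [hv]
    exact b.ofZLatticeBasis_repr_apply ℝ L ⟨x, hx⟩ i

/-- There is a nearly shortest nonzero dual vector. -/
theorem exists_almost_shortest_isDualVector [FiniteDimensional ℝ E] [Nontrivial E]
    (L : Submodule ℤ E) [DiscreteTopology L] [IsZLattice ℝ L] {M : ℝ} (hM : 0 < M)
    (hL : ∀ v, v ≠ 0 → IsDualVector L v → M ≤ ‖v‖ ^ 2) :
    ∃ v, v ≠ 0 ∧ IsDualVector L v ∧
      ∀ u, u ≠ 0 → IsDualVector L u → 9 / 10 * ‖v‖ ^ 2 ≤ ‖u‖ ^ 2 := by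
  let S : Set ℝ := {r | ∃ v, v ≠ 0 ∧ IsDualVector L v ∧ r = ‖v‖ ^ 2}
  obtain ⟨v₀, h1, h2⟩ := exists_isDualVector_ne_zero L
  have hne : S.Nonempty := ⟨_, v₀, h1, h2, rfl⟩
  have hMS : M ≤ sInf S := by
    refine le_csInf hne ?_
    rintro _ ⟨v, hv, hv', rfl⟩
    exact hL v hv hv'
  have hbdd : BddBelow S := ⟨0, by rintro _ ⟨v, -, -, rfl⟩; positivity⟩
  obtain ⟨_, ⟨v, hv, hv', rfl⟩, hlt⟩ := exists_lt_of_csInf_lt hne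
    (show sInf S < 10 / 9 * sInf S by linarith)
  refine ⟨v, hv, hv', fun u hu hu' => ?_⟩
  have : sInf S ≤ ‖u‖ ^ 2 := csInf_le hbdd ⟨u, hu, hu', rfl⟩
  linarith

/-- A nearly shortest dual vector takes the value `1` on the lattice. -/
theorem exists_inner_eq_one (L : Submodule ℤ E) [DiscreteTopology L] [IsZLattice ℝ L] {v : E}
    (hv : v ≠ 0) (hvL : IsDualVector L v)
    (hmin : ∀ u, u ≠ 0 → IsDualVector L u → 9 / 10 * ‖v‖ ^ 2 ≤ ‖u‖ ^ 2) :
    ∃ x ∈ L, inner ℝ v x = 1 := by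
  -- The values of `v` on `L` form an ideal of `ℤ`. If its generator `g` had `|g| ≥ 2`, then `g⁻¹ •
  -- v` would be a dual vector of at most a quarter of the squared length, against `9 / 10`.
  let G : Submodule ℤ ℤ :=
    { carrier := {k | ∃ x ∈ L, inner ℝ v x = k}
      add_mem' := by
        rintro a b ⟨x, hx, hxa⟩ ⟨y, hy, hyb⟩
        exact ⟨x + y, add_mem hx hy, by rw [inner_add_right, hxa, hyb]; push_cast; rfl⟩
      zero_mem' := ⟨0, zero_mem _, by simp⟩
      smul_mem' := by
        rintro c a ⟨x, hx, hxa⟩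
        refine ⟨c • x, L.smul_mem c hx, ?_⟩
        rw [← Int.cast_smul_eq_zsmul ℝ c x, inner_smul_right, hxa, smul_eq_mul]
        push_cast; rfl }
  obtain ⟨g, hg⟩ := (IsPrincipalIdealRing.principal G).principal
  have hgG : ∀ x ∈ L, ∃ c : ℤ, inner ℝ v x = c * g := by
    intro x hx
    obtain ⟨k, hk⟩ := hvL x hx
    have hkG : k ∈ G := ⟨x, hx, hk⟩
    rw [hg, Submodule.mem_span_singleton] at hkG
    obtain ⟨c, rfl⟩ := hkG
    exact ⟨c, by rw [hk, smul_eq_mul]; push_cast; rfl⟩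
  have hv2 : 0 < ‖v‖ ^ 2 := by positivity
  have hg0 : g ≠ 0 := by
    rintro rfl
    have hker : (⊤ : Submodule ℝ E) ≤ LinearMap.ker (innerₛₗ ℝ v) := by
      rw [← IsZLattice.span_top (K := ℝ) (L := L), Submodule.span_le]
      intro x hx
      obtain ⟨c, hc⟩ := hgG x hx
      simpa using hc
    have : inner ℝ v v = 0 := hker (Submodule.mem_top (x := v))
    exact hv (inner_self_eq_zero.1 this)
  have hg1 : |g| = 1 := by
    by_contra hne
    have h2 : 2 ≤ |g| := by
      have := Int.one_le_abs hg0
      omega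
    have h2' : (4 : ℝ) ≤ (g : ℝ) ^ 2 := by
      have : (2 : ℝ) ≤ |(g : ℝ)| := by exact_mod_cast h2
      rw [← sq_abs]; nlinarith
    have hgR : (g : ℝ) ≠ 0 := Int.cast_ne_zero.2 hg0
    have := hmin ((g : ℝ)⁻¹ • v) (smul_ne_zero (inv_ne_zero hgR) hv) (fun x hx => by
      obtain ⟨c, hc⟩ := hgG x hx
      refine ⟨c, ?_⟩
      rw [real_inner_smul_left, hc]; field_simp)
    rw [norm_smul, mul_pow, norm_inv, inv_pow, Real.norm_eq_abs, sq_abs] at this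
    have h3 : ((g : ℝ) ^ 2)⁻¹ ≤ 4⁻¹ := inv_anti₀ (by norm_num) h2'
    nlinarith
  have h1 : (1 : ℤ) ∈ G := by
    rw [hg, Submodule.mem_span_singleton]
    exact ⟨g, by rw [smul_eq_mul, ← abs_mul_abs_self, hg1, one_mul]⟩
  obtain ⟨x, hx, h⟩ := h1
  exact ⟨x, hx, by simpa using h⟩

/-- The hyperplane section of a lattice by the orthogonal of a primitive dual vector spans. -/
theorem isZLattice_orthogonal (L : Submodule ℤ E) [DiscreteTopology L] [IsZLattice ℝ L] {v e : E}
    (hvL : IsDualVector L v) (he : e ∈ L) (hve : inner ℝ v e = (1 : ℝ))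
    [DiscreteTopology (ZLattice.comap ℝ L (ℝ ∙ v)ᗮ.subtype)] :
    IsZLattice ℝ (ZLattice.comap ℝ L (ℝ ∙ v)ᗮ.subtype) := by
  constructor
  -- Projection along `e`, not the orthogonal one: it maps `L` into itself because `v` is integral
  -- on `L` and `e ∈ L`.
  let π : E →ₗ[ℝ] (ℝ ∙ v)ᗮ := LinearMap.codRestrict _
    (LinearMap.id - (innerₛₗ ℝ v).smulRight e) (fun x => by
      rw [Submodule.mem_orthogonal_singleton_iff_inner_right]
      simp [inner_sub_right, inner_smul_right, hve])
  have hπ : ∀ x, (π x : E) = x - (inner ℝ v x : ℝ) • e := fun x => rfl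
  rw [eq_top_iff]
  intro h _
  have hh : π h = h := by
    ext
    rw [hπ, (Submodule.mem_orthogonal_singleton_iff_inner_right).1 h.2, zero_smul, sub_zero]
  have hmem : π h ∈ Submodule.map π (Submodule.span ℝ (L : Set E)) :=
    Submodule.mem_map_of_mem (by rw [IsZLattice.span_top]; trivial)
  rw [Submodule.map_span, hh] at hmem
  refine Submodule.span_mono ?_ hmem
  rintro _ ⟨x, hx, rfl⟩
  obtain ⟨k, hk⟩ := hvL x hx
  change (π x : E) ∈ L
  rw [hπ, hk, Int.cast_smul_eq_zsmul]
  exact sub_mem hx (L.smul_mem k he)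

/-- If all nonzero dual vectors of a lattice have squared length at least `M`, then the square of
the covering radius is at most `(2 ^ n - 1) / M`. -/
theorem exists_norm_sub_sq_le (n : ℕ) : ∀ (E : Type*) [NormedAddCommGroup E]
    [InnerProductSpace ℝ E] [FiniteDimensional ℝ E] (L : Submodule ℤ E) [DiscreteTopology L]
    [IsZLattice ℝ L], finrank ℝ E = n → ∀ M : ℝ, 0 < M →
    (∀ v, v ≠ 0 → IsDualVector L v → M ≤ ‖v‖ ^ 2) →
    ∀ x : E, ∃ y ∈ L, ‖x - y‖ ^ 2 ≤ (2 ^ n - 1) / M := by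
  induction n with
  | zero =>
    intro E _ _ _ L _ _ hE M hM hL x
    have := finrank_zero_iff.1 hE
    exact ⟨0, zero_mem _, by rw [Subsingleton.elim (x - 0) 0]; simp⟩
  | succ n ih =>
    intro E _ _ _ L _ _ hE M hM hL x
    have : Nontrivial E := nontrivial_of_finrank_pos (R := ℝ) (by omega)
    have : Fact (finrank ℝ E = n + 1) := ⟨hE⟩
    obtain ⟨v, hv, hvL, hmin⟩ := exists_almost_shortest_isDualVector L hM hL
    obtain ⟨e, he, hve⟩ := exists_inner_eq_one L hv hvL hmin
    have hv2 : 0 < ‖v‖ ^ 2 := by positivity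
    have hMv := hL v hv hvL
    set H := (ℝ ∙ v)ᗮ with hH
    have hHv : ∀ h : H, inner ℝ v (h : E) = 0 := fun h =>
      Submodule.mem_orthogonal_singleton_iff_inner_right.1 h.2
    have : DiscreteTopology (ZLattice.comap ℝ L H.subtype) :=
      ZLattice.comap_discreteTopology ℝ L H.subtypeL.continuous H.injective_subtype
    have : IsZLattice ℝ (ZLattice.comap ℝ L H.subtype) := isZLattice_orthogonal L hvL he hve
    have hpyth : ∀ (h : H) (t : ℝ), ‖(h : E) + t • v‖ ^ 2 = ‖h‖ ^ 2 + t ^ 2 * ‖v‖ ^ 2 := by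
      intro h t
      rw [norm_add_sq_real, inner_smul_right, real_inner_comm, hHv, norm_smul, mul_pow,
        Real.norm_eq_abs, sq_abs]
      simp
    have hdual : ∀ u : H, u ≠ 0 → IsDualVector (ZLattice.comap ℝ L H.subtype) u →
        ‖v‖ ^ 2 / 2 ≤ ‖u‖ ^ 2 := by
      intro u hu huL
      -- Adding `t • v` makes the value of `u` at `e` an integer, lifting `u` to a dual vector of
      -- `L`. As `t ^ 2 ≤ 1 / 4`, near-minimality of `v` gives `‖u‖ ^ 2 ≥ (9/10 - 1/4) * ‖v‖ ^ 2`.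
      set t : ℝ := round (inner ℝ (u : E) e) - inner ℝ (u : E) e with ht
      have ht2 : t ^ 2 ≤ 1 / 4 := by
        have := abs_sub_round (inner ℝ (u : E) e)
        rw [abs_sub_comm, ← ht] at this
        rw [← sq_abs]; nlinarith [abs_nonneg t]
      have hu2 : 0 < ‖u‖ ^ 2 := by positivity
      have h1 := hmin ((u : E) + t • v) (fun h0 => by
        have := hpyth u t
        rw [h0, norm_zero] at this
        nlinarith [mul_nonneg (sq_nonneg t) hv2.le]) (fun y hy => by
          obtain ⟨k, hk⟩ := hvL y hy
          have hy' : y - k • e ∈ H := by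
            rw [hH, Submodule.mem_orthogonal_singleton_iff_inner_right, inner_sub_right, hk,
              ← Int.cast_smul_eq_zsmul ℝ, inner_smul_right, hve]
            simp
          obtain ⟨l, hl⟩ := huL ⟨y - k • e, hy'⟩ (sub_mem hy (L.smul_mem k he))
          refine ⟨l + k * round (inner ℝ (u : E) e), ?_⟩
          have hl' : inner ℝ (u : E) (y - k • e) = (l : ℝ) := hl
          rw [inner_sub_right, ← Int.cast_smul_eq_zsmul ℝ, inner_smul_right] at hl'
          rw [inner_add_left, real_inner_smul_left, hk, ht]
          push_cast
          linarith)
      rw [hpyth] at h1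
      nlinarith
    have hHfin : finrank ℝ H = n := Submodule.finrank_orthogonal_span_singleton hv
    -- Move to the nearest layer `k • e + H`, at squared distance `s ^ 2 / ‖v‖ ^ 2`, and recurse in
    -- `H`; the totals close up since `2 * (2 ^ n - 1) + 1 / 4 ≤ 2 ^ (n + 1) - 1`.
    set k := round (inner ℝ v x : ℝ) with hk
    set s : ℝ := inner ℝ v x - k with hs
    have hs2 : s ^ 2 ≤ 1 / 4 := by
      have := abs_sub_round (inner ℝ v x : ℝ)
      rw [← hk, ← hs] at this
      rw [← sq_abs]; nlinarith [abs_nonneg s]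
    have hmem : x - k • e - (s / ‖v‖ ^ 2) • v ∈ H := by
      rw [hH, Submodule.mem_orthogonal_singleton_iff_inner_right, inner_sub_right,
        inner_sub_right, inner_smul_right, ← Int.cast_smul_eq_zsmul ℝ, inner_smul_right, hve,
        real_inner_self_eq_norm_sq, div_mul_cancel₀ _ hv2.ne', hs]
      ring
    obtain ⟨y, hy, hyle⟩ := ih H (ZLattice.comap ℝ L H.subtype) hHfin (‖v‖ ^ 2 / 2) (by positivity)
      hdual ⟨_, hmem⟩
    refine ⟨k • e + y, add_mem (L.smul_mem k he) hy, ?_⟩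
    have h1 : x - (k • e + y) =
        ((⟨x - k • e - (s / ‖v‖ ^ 2) • v, hmem⟩ - y : H) : E) + (s / ‖v‖ ^ 2) • v := by
      push_cast
      abel
    rw [h1, hpyth]
    have h2 : (s / ‖v‖ ^ 2) ^ 2 * ‖v‖ ^ 2 = s ^ 2 / ‖v‖ ^ 2 := by field_simp
    rw [h2]
    have h3 : s ^ 2 / ‖v‖ ^ 2 ≤ (1 / 4) / ‖v‖ ^ 2 := div_le_div_of_nonneg_right hs2 hv2.le
    have h4 : ((2 : ℝ) ^ (n + 1) - 1) / ‖v‖ ^ 2 ≤ (2 ^ (n + 1) - 1) / M := by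
      refine div_le_div_of_nonneg_left ?_ hM hMv
      have := one_le_pow₀ (one_le_two (α := ℝ)) (n := n + 1)
      linarith
    refine le_trans (add_le_add hyle h3) (le_trans ?_ h4)
    rw [div_div_eq_mul_div, ← add_div]
    refine div_le_div_of_nonneg_right ?_ hv2.le
    rw [pow_succ]; linarith

end Transference

/-! ### The trace dual of the ring of integers -/

section TraceDual

open mixedEmbedding

theorem re_embedding_of_isReal {K : Type*} [Field K] {w : InfinitePlace K} (hw : IsReal w) (z : K) :
    (w.embedding z).re = embedding_of_isReal hw z := by
  rw [← embedding_of_isReal_apply hw, Complex.ofReal_re]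

variable {K : Type*} [Field K] [NumberField K]

/-- An element of the trace dual of `𝓞 K` has norm at least `1 / |D_K|`. -/
theorem one_le_abs_norm_mul_discr {y : K} (hy : y ≠ 0)
    (h : ∀ x : 𝓞 K, ∃ k : ℤ, Algebra.trace ℚ K (y * x) = k) :
    1 ≤ |(Algebra.norm ℚ y : ℝ)| * |(discr K : ℝ)| := by
  classical
  let b := integralBasis K
  choose c hc using h
  let T : Matrix (Module.Free.ChooseBasisIndex ℤ (𝓞 K)) (Module.Free.ChooseBasisIndex ℤ (𝓞 K)) ℤ :=
    fun i k => c (RingOfIntegers.basis K k * RingOfIntegers.basis K i)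
  -- The integral matrix of `Tr(y b_k b_i)` factors through multiplication by `y`, so its
  -- determinant `D_K * N(y)` is a nonzero integer.
  have hT : T.map (Int.cast : ℤ → ℚ) = Algebra.traceMatrix ℚ b * Algebra.leftMulMatrix b y := by
    ext i k
    have h1 := congrFun (Algebra.traceMatrix_of_basis_mulVec (A := ℚ) b (y * b k)) i
    have h2 : (Algebra.traceMatrix ℚ b * Algebra.leftMulMatrix b y) i k =
        Algebra.trace ℚ K (y * b k * b i) := by
      rw [← h1, Matrix.mul_apply, Matrix.mulVec, dotProduct]
      refine Finset.sum_congr rfl fun l _ => ?_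
      rw [Algebra.leftMulMatrix_eq_repr_mul, Module.Basis.equivFun_apply]
    rw [h2, Matrix.map_apply, ← hc, mul_assoc]
    simp [b]
  have hdet : ((T.det : ℤ) : ℚ) = discr K * Algebra.norm ℚ y := by
    rw [coe_discr, Algebra.discr_def, Algebra.norm_eq_matrix_det b, ← Matrix.det_mul, ← hT]
    exact (Int.castRingHom ℚ).map_det T
  have hne : T.det ≠ 0 := by
    intro h0
    rw [h0, Int.cast_zero, eq_comm, mul_eq_zero] at hdet
    rcases hdet with h | h
    · exact discr_ne_zero K (by exact_mod_cast h)
    · exact hy (Algebra.norm_eq_zero_iff.1 h)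
  have h1 : (1 : ℝ) ≤ |((T.det : ℤ) : ℝ)| := by exact_mod_cast Int.one_le_abs hne
  have h2 : ((T.det : ℤ) : ℝ) = discr K * (Algebra.norm ℚ y : ℝ) := by
    have : (((T.det : ℤ) : ℚ) : ℝ) = ((discr K * Algebra.norm ℚ y : ℚ) : ℝ) := by rw [hdet]
    rwa [Rat.cast_intCast, Rat.cast_mul, Rat.cast_intCast] at this
  rwa [h2, abs_mul, mul_comm] at h1

theorem trace_eq_sum_places (z : K) :
    (Algebra.trace ℚ K z : ℝ) = ∑ w, mult w * (w.embedding z).re := by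
  classical
  have h1 : ((Algebra.trace ℚ K z : ℝ) : ℂ) = ∑ φ : K →+* ℂ, φ z := by
    have := trace_eq_sum_embeddings (K := ℚ) ℂ (x := z)
    rw [← (RingHom.equivRatAlgHom K ℂ).sum_comp] at this
    simpa using this
  have h2 := qForm_mixedEmbedding (fun _ => 1) z 1
  simp only [map_one, mul_one, Complex.ofReal_one, one_mul] at h2
  rw [← h2] at h1
  rw [Complex.ofReal_injective h1, sum_eq_sum_isReal_add_sum_isComplex, qForm]
  congr 1
  · refine Finset.sum_congr (by congr!) fun w _ => ?_
    rw [mult_isReal, mixedEmbedding_apply_isReal, re_embedding_of_isReal w.2]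
    simp
  · refine Finset.sum_congr (by congr!) fun w _ => ?_
    rw [mult_isComplex, mixedEmbedding_apply_isComplex]
    simp

open Classical in
/-- The vector of the Euclidean mixed space representing the functional `x ↦ Tr(y x)`. -/
noncomputable def traceVector (y : K) : euclidean.mixedSpace K :=
  WithLp.toLp 2 (WithLp.toLp 2 fun w => embedding_of_isReal w.2 y,
    WithLp.toLp 2 fun w => 2 * (starRingEnd ℂ) (w.1.embedding y))

open Classical in
theorem inner_traceVector (x y : K) :
    inner ℝ (traceVector y) ((euclidean.toMixed K).symm (mixedEmbedding K x)) =
      (Algebra.trace ℚ K (y * x) : ℝ) := by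
  rw [trace_eq_sum_places, sum_eq_sum_isReal_add_sum_isComplex, WithLp.prod_inner_apply,
    PiLp.inner_apply, PiLp.inner_apply]
  congr 1
  · refine Finset.sum_congr (by congr!) fun w _ => ?_
    rw [mult_isReal, re_embedding_of_isReal w.2]
    simp [traceVector, euclidean.toMixed]
    ring
  · refine Finset.sum_congr (by congr!) fun w _ => ?_
    rw [mult_isComplex]
    simp [traceVector, euclidean.toMixed, Complex.inner]
    ring

open Classical in
theorem le_norm_traceVector (y : K) (w : InfinitePlace K) : w y ≤ ‖traceVector y‖ := by
  rcases isReal_or_isComplex w with hw | hw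
  · have h1 : ‖(traceVector y).fst‖ ≤ ‖traceVector y‖ := by
      apply WithLp.norm_fst_le
    have h2 : ‖(traceVector y).fst ⟨w, hw⟩‖ ≤ ‖(traceVector y).fst‖ := PiLp.norm_apply_le _ _
    refine le_trans (le_of_eq ?_) (h2.trans h1)
    exact (norm_embedding_of_isReal hw y).symm
  · have h1 : ‖(traceVector y).snd‖ ≤ ‖traceVector y‖ := by
      apply WithLp.norm_snd_le
    have h2 : ‖(traceVector y).snd ⟨w, hw⟩‖ ≤ ‖(traceVector y).snd‖ := PiLp.norm_apply_le _ _
    refine le_trans ?_ (h2.trans h1)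
    have h3 : ‖(traceVector y).snd ⟨w, hw⟩‖ = 2 * w y := by
      rw [← norm_embedding_eq w y]
      simp [traceVector]
    rw [h3]
    have := apply_nonneg w y
    linarith

open Classical in
/-- Every dual vector of the lattice of integers comes from the trace dual. -/
theorem exists_eq_traceVector {v : euclidean.mixedSpace K}
    (hv : IsDualVector (euclidean.integerLattice K) v) :
    ∃ y : K, v = traceVector y ∧ ∀ x : 𝓞 K, ∃ k : ℤ, Algebra.trace ℚ K (y * x) = k := by
  have hmem : ∀ x : 𝓞 K, (euclidean.toMixed K).symm (mixedEmbedding K (x : K)) ∈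
      euclidean.integerLattice K := by
    intro x
    change (euclidean.toMixed K) _ ∈ mixedEmbedding.integerLattice K
    rw [ContinuousLinearEquiv.apply_symm_apply]
    exact ⟨x, rfl⟩
  choose c hc using fun x : 𝓞 K => hv _ (hmem x)
  let b := integralBasis K
  -- The trace-dual basis is weighted by the values of `v`, so `traceVector y` and `v` agree on a
  -- real basis.
  let y : K := ∑ i, (c (RingOfIntegers.basis K i) : ℚ) • b.traceDual i
  have hy : ∀ i, Algebra.trace ℚ K (y * b i) = c (RingOfIntegers.basis K i) := by
    intro i
    simp only [y, Finset.sum_mul, smul_mul_assoc, map_sum, map_smul,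
      Module.Basis.trace_traceDual_mul]
    simp
  have hvy : v = traceVector y := by
    rw [← sub_eq_zero, ← inner_self_eq_zero (𝕜 := ℝ)]
    have hker : (⊤ : Submodule ℝ (euclidean.mixedSpace K)) ≤
        LinearMap.ker (innerₛₗ ℝ (v - traceVector y)) := by
      have hspan := ((latticeBasis K).map (euclidean.toMixed K).toLinearEquiv.symm).span_eq
      rw [← hspan, Submodule.span_le]
      rintro _ ⟨i, rfl⟩
      have h1 := inner_traceVector (b i) y
      have h2 := hc (RingOfIntegers.basis K i)
      rw [hy] at h1
      have e : (b i : K) = (RingOfIntegers.basis K i : K) := integralBasis_apply K i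
      rw [← e] at h2
      have e2 : ((latticeBasis K).map (euclidean.toMixed K).toLinearEquiv.symm) i =
          (euclidean.toMixed K).symm (mixedEmbedding K (b i)) := by
        rw [Module.Basis.map_apply, latticeBasis_apply]; rfl
      rw [SetLike.mem_coe, LinearMap.mem_ker, e2, innerₛₗ_apply_apply, inner_sub_left, h1, h2]
      simp
    exact hker (Submodule.mem_top (x := v - traceVector y))
  refine ⟨y, hvy, fun x => ⟨c x, ?_⟩⟩
  have h1 := inner_traceVector (x : K) y
  rw [← hvy, hc x] at h1
  exact_mod_cast h1.symm

-- All absolute values of `y` are at most `‖traceVector y‖`, so `|N(y)| ≤ ‖v‖ ^ d`, while `|N(y)| ≥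
-- 1 / |D_K|` on the trace dual.
open Classical in
theorem le_norm_sq_of_isDualVector {v : euclidean.mixedSpace K} (hv0 : v ≠ 0)
    (hv : IsDualVector (euclidean.integerLattice K) v) :
    |(discr K : ℝ)| ^ (-(2 / (Module.finrank ℚ K : ℝ))) ≤ ‖v‖ ^ 2 := by
  obtain ⟨y, rfl, hy⟩ := exists_eq_traceVector hv
  have hy0 : y ≠ 0 := by
    rintro rfl
    refine hv0 ?_
    apply (WithLp.equiv 2 _).injective
    ext <;> simp [traceVector]
  set d := Module.finrank ℚ K
  have hd0 : (d : ℝ) ≠ 0 := by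
    have : d ≠ 0 := Module.finrank_pos.ne'
    exact_mod_cast this
  have hD : 0 < |(discr K : ℝ)| := abs_pos.2 (Int.cast_ne_zero.2 (discr_ne_zero K))
  have h1 := one_le_abs_norm_mul_discr hy0 hy
  have h2 : |(Algebra.norm ℚ y : ℝ)| ≤ ‖traceVector y‖ ^ d := by
    have := prod_eq_abs_norm y
    rw [Rat.cast_abs] at this
    change _ ≤ _ ^ Module.finrank ℚ K
    rw [← this, ← sum_mult_eq, ← Finset.prod_pow_eq_pow_sum]
    exact Finset.prod_le_prod (fun w _ => pow_nonneg (apply_nonneg w y) _) fun w _ =>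
      pow_le_pow_left₀ (apply_nonneg w y) (le_norm_traceVector y w) _
  have h3 : |(discr K : ℝ)|⁻¹ ≤ ‖traceVector y‖ ^ d := by
    refine le_trans ?_ h2
    rw [inv_eq_one_div, div_le_iff₀ hD]
    exact h1
  have h4 := Real.rpow_le_rpow (by positivity) h3 (show 0 ≤ 2 / (d : ℝ) by positivity)
  rw [Real.inv_rpow hD.le, ← Real.rpow_neg hD.le] at h4
  refine h4.trans (le_of_eq ?_)
  rw [← Real.rpow_natCast, ← Real.rpow_mul (norm_nonneg _), mul_div_cancel₀ _ hd0, Real.rpow_two]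

open Classical in
/-- The minimal thickness is bounded in terms of the discriminant. -/
theorem tauMin_le : tauMin K ≤
    2 ^ (Module.finrank ℚ K + 1) * |(discr K : ℝ)| ^ (1 / (Module.finrank ℚ K : ℝ)) := by
  set d := Module.finrank ℚ K
  have hD : 0 < |(discr K : ℝ)| := abs_pos.2 (Int.cast_ne_zero.2 (discr_ne_zero K))
  set M : ℝ := |(discr K : ℝ)| ^ (-(2 / (d : ℝ))) with hM
  have hM0 : 0 < M := Real.rpow_pos_of_pos hD _
  have hcov := exists_norm_sub_sq_le d (euclidean.mixedSpace K) (euclidean.integerLattice K)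
    (euclidean.finrank K) M hM0 (fun v h0 hv => le_norm_sq_of_isDualVector h0 hv)
  -- The factor `2` is the weight of the complex places in `q_1` relative to the Euclidean norm.
  have hmax : latticeMax K (fun _ => 1) ≤ 2 * ((2 ^ d - 1) / M) := by
    refine csInf_le ⟨0, fun u hu => ?_⟩ fun x => ?_
    · obtain ⟨y, hy⟩ := hu 0
      exact (qForm_self_nonneg _ (fun _ => one_pos) _).trans hy
    · obtain ⟨y, hy, hle⟩ := hcov ((euclidean.toMixed K).symm x)
      obtain ⟨z, hz⟩ : (euclidean.toMixed K) y ∈ mixedEmbedding.integerLattice K := hy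
      have hz' : mixedEmbedding K (z : K) = euclidean.toMixed K y := hz
      refine ⟨z, le_trans ?_ (mul_le_mul_of_nonneg_left hle zero_le_two)⟩
      set u := (euclidean.toMixed K).symm x - y with hu
      have hxu : x - mixedEmbedding K (z : K) = euclidean.toMixed K u := by
        rw [hz', hu, map_sub, ContinuousLinearEquiv.apply_symm_apply]
      rw [hxu, qForm_self, sum_eq_sum_isReal_add_sum_isComplex, WithLp.prod_norm_sq_eq_of_L2,
        EuclideanSpace.norm_sq_eq, EuclideanSpace.norm_sq_eq, mul_add, Finset.mul_sum,
        Finset.mul_sum]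
      refine add_le_add (Finset.sum_le_sum fun w _ => ?_) (Finset.sum_le_sum fun w _ => ?_)
      · rw [mult_isReal, normAtPlace_apply_of_isReal w.2]
        have e : ‖(euclidean.toMixed K u).1 w‖ = ‖u.fst w‖ := rfl
        rw [e]
        push_cast
        nlinarith [sq_nonneg ‖u.fst w‖]
      · rw [mult_isComplex, normAtPlace_apply_of_isComplex w.2]
        have e : ‖(euclidean.toMixed K u).2 w‖ = ‖u.snd w‖ := rfl
        rw [e]
        push_cast
        linarith
  have hdet : latticeDet K (fun _ => 1) = |(discr K : ℝ)| := by
    rw [latticeDet_eq]; simp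
  have hth : tauMin K ≤ thickness K (fun _ => 1) :=
    csInf_le ⟨0, by rintro _ ⟨α, hα, rfl⟩; exact thickness_nonneg α hα⟩
      ⟨_, fun _ => one_pos, rfl⟩
  refine hth.trans ?_
  rw [thickness, hdet, div_le_iff₀ (Real.rpow_pos_of_pos hD _), mul_assoc, ← Real.rpow_add hD]
  refine hmax.trans ?_
  have e : M⁻¹ = |(discr K : ℝ)| ^ (1 / (d : ℝ) + 1 / (d : ℝ)) := by
    rw [hM, ← Real.rpow_neg hD.le]
    congr 1; ring
  rw [← e, div_eq_mul_inv, ← mul_assoc, pow_succ]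
  refine mul_le_mul_of_nonneg_right ?_ (inv_nonneg.2 hM0.le)
  linarith

end TraceDual

/-! ### Perron numbers -/

section Perron

variable {lam : ℝ}

theorem IsPerron.finite_ratios :
    {r : ℝ | ∃ z ∈ (minpoly ℚ lam).rootSet ℂ, z ≠ (lam : ℂ) ∧ r = ‖z‖ / lam}.Finite := by
  refine (((minpoly ℚ lam).rootSet_finite ℂ).image fun z => ‖z‖ / lam).subset ?_
  rintro _ ⟨z, hz, -, rfl⟩
  exact ⟨z, hz, rfl⟩

theorem IsPerron.pos (h : IsPerron lam) : 0 < lam := zero_lt_one.trans_le h.one_le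

theorem IsPerron.spectralRatio_nonneg (h : IsPerron lam) : 0 ≤ spectralRatio lam := by
  refine Real.sSup_nonneg ?_
  rintro _ ⟨z, -, -, rfl⟩
  exact div_nonneg (norm_nonneg _) h.pos.le

theorem IsPerron.spectralRatio_lt_one (h : IsPerron lam) : spectralRatio lam < 1 := by
  rcases Set.eq_empty_or_nonempty
    {r : ℝ | ∃ z ∈ (minpoly ℚ lam).rootSet ℂ, z ≠ (lam : ℂ) ∧ r = ‖z‖ / lam} with h0 | hne
  · rw [spectralRatio, h0, Real.sSup_empty]; exact zero_lt_one
  · obtain ⟨z, hz, hzne, e⟩ := hne.csSup_mem IsPerron.finite_ratios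
    rw [spectralRatio, e, div_lt_one h.pos]
    exact h.norm_lt z hz hzne

theorem IsPerron.norm_le (h : IsPerron lam) {z : ℂ} (hz : z ∈ (minpoly ℚ lam).rootSet ℂ)
    (hne : z ≠ lam) : ‖z‖ ≤ spectralRatio lam * lam := by
  rw [← div_le_iff₀ h.pos]
  exact le_csSup IsPerron.finite_ratios.bddAbove ⟨z, hz, hne, rfl⟩

theorem IsPerron.one_lt (h : IsPerron lam) (hd : 2 ≤ (minpoly ℚ lam).natDegree) : 1 < lam := by
  refine lt_of_le_of_ne h.one_le fun h1 => ?_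
  rw [← h1, minpoly.one, ← Polynomial.C_1, Polynomial.natDegree_X_sub_C] at hd
  omega

/-- The place of `ℚ(λ)` given by the inclusion into `ℝ`. -/
noncomputable def inclusionPlace (lam : ℝ) : InfinitePlace ℚ⟮lam⟯ :=
  mk (Complex.ofRealHom.comp (algebraMap ℚ⟮lam⟯ ℝ))

theorem isReal_ofReal_comp {K : Type*} [Field K] (j : K →+* ℝ) :
    ComplexEmbedding.IsReal (Complex.ofRealHom.comp j) := by
  rw [ComplexEmbedding.isReal_iff]
  ext x
  simp [ComplexEmbedding.conjugate_coe_eq]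

theorem isReal_inclusionPlace (lam : ℝ) : IsReal (inclusionPlace lam) :=
  ⟨_, isReal_ofReal_comp _, rfl⟩

theorem embedding_inclusionPlace (lam : ℝ) (x : ℚ⟮lam⟯) :
    embedding_of_isReal (isReal_inclusionPlace lam) x = algebraMap ℚ⟮lam⟯ ℝ x := by
  apply Complex.ofReal_injective
  rw [embedding_of_isReal_apply, inclusionPlace, embedding_mk_eq_of_isReal (isReal_ofReal_comp _)]
  rfl

/-- A Perron number as an integer of the field it generates. -/
noncomputable def IsPerron.toInteger (h : IsPerron lam) : 𝓞 ℚ⟮lam⟯ :=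
  ⟨IntermediateField.AdjoinSimple.gen ℚ lam,
    (isIntegral_algHom_iff ((ℚ⟮lam⟯).val.restrictScalars ℤ) Subtype.val_injective).1 h.isIntegral⟩

/-- An embedding fixing `lam` is the inclusion, because `lam` generates the field; every other place
sends it to a different conjugate. -/
theorem IsPerron.place_le (h : IsPerron lam) {w : InfinitePlace ℚ⟮lam⟯}
    (hw : w ≠ inclusionPlace lam) : w (h.toInteger : ℚ⟮lam⟯) ≤ spectralRatio lam * lam := by
  have hgen : (h.toInteger : ℚ⟮lam⟯) = IntermediateField.AdjoinSimple.gen ℚ lam := rfl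
  rw [hgen, ← norm_embedding_eq]
  set σ := w.embedding.toRatAlgHom with hσ
  refine h.norm_le (z := σ (IntermediateField.AdjoinSimple.gen ℚ lam)) ?_ fun heq => hw ?_
  · rw [Polynomial.mem_rootSet]
    refine ⟨minpoly.ne_zero h.isIntegral.tower_top, ?_⟩
    rw [← IntermediateField.minpoly_gen, Polynomial.aeval_algHom_apply]
    exact (congrArg σ (minpoly.aeval ℚ _)).trans (map_zero σ)
  · have hext : σ = (Complex.ofRealHom.comp (algebraMap ℚ⟮lam⟯ ℝ)).toRatAlgHom := by
      refine IntermediateField.algHom_ext_of_eq_adjoin _ (s := {lam}) rfl ?_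
      rintro x rfl
      exact heq
    rw [← mk_embedding w, inclusionPlace]
    congr 1
    ext x
    exact DFunLike.congr_fun hext x

end Perron

/-- With `y = 8d / (1 - ρ)`, the hypothesis `3 ≤ d` gives `y ≥ 24 / (1 - ρ) ≥ 24`, hence `60 / (1 -
ρ) ≤ y ^ 2 ≤ y ^ d`. -/
theorem pow_le_pow_sq_of_three_le {d : ℕ} (hd : 3 ≤ d) {ρ : ℝ} (hρ0 : 0 ≤ ρ) (hρ : ρ < 1) :
    (60 / (1 - ρ)) ^ d * (2 ^ d) ^ d ≤ 2 ^ (d ^ 2) * (8 * (d : ℝ) / (1 - ρ)) ^ (d ^ 2) := by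
  have hρ' : 0 < 1 - ρ := by linarith
  have hd' : (3 : ℝ) ≤ d := by exact_mod_cast hd
  set y := 8 * (d : ℝ) / (1 - ρ) with hy
  have h1 : 24 / (1 - ρ) ≤ y := div_le_div_of_nonneg_right (by linarith) hρ'.le
  have h24 : 24 ≤ 24 / (1 - ρ) := by rw [le_div_iff₀ hρ']; linarith
  have h60 : 60 / (1 - ρ) = 24 / (1 - ρ) * (5 / 2) := by ring
  have h2 : 60 / (1 - ρ) ≤ y ^ d := by
    calc 60 / (1 - ρ) ≤ y ^ 2 := by rw [h60]; nlinarith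
      _ ≤ y ^ d := pow_le_pow_right₀ (by linarith) (by omega)
  have h3 : (60 / (1 - ρ)) ^ d ≤ (y ^ d) ^ d := pow_le_pow_left₀ (by positivity) h2 d
  rw [pow_two, pow_mul, pow_mul, mul_comm]
  exact mul_le_mul_of_nonneg_left h3 (by positivity)

theorem tauMin_rpow_le (K : Type*) [Field K] [NumberField K] :
    tauMin K ^ ((Module.finrank ℚ K : ℝ) / 2) ≤
      (2 ^ Module.finrank ℚ K) ^ Module.finrank ℚ K * √|(discr K : ℝ)| := by
  have hd1 : 1 ≤ Module.finrank ℚ K := Module.finrank_pos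
  have h := tauMin_le (K := K)
  set d := Module.finrank ℚ K
  have hd0 : (d : ℝ) ≠ 0 := by exact_mod_cast (by omega : d ≠ 0)
  have hD : 0 ≤ |(discr K : ℝ)| := abs_nonneg _
  refine (Real.rpow_le_rpow tauMin_nonneg h (by positivity)).trans ?_
  rw [Real.mul_rpow (by positivity) (Real.rpow_nonneg hD _), ← Real.rpow_mul hD]
  refine mul_le_mul ?_ (le_of_eq ?_) (Real.rpow_nonneg hD _) (by positivity)
  · have h1 : (2 : ℝ) ^ (d + 1) ≤ (2 ^ d) ^ 2 := by
      rw [← pow_mul]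
      exact pow_le_pow_right₀ one_le_two (by omega)
    refine (Real.rpow_le_rpow (by positivity) h1 (by positivity)).trans (le_of_eq ?_)
    rw [← Real.rpow_natCast (2 ^ d) 2, ← Real.rpow_mul (by positivity),
      ← Real.rpow_natCast (2 ^ d) d]
    congr 1
    push_cast; ring
  · rw [Real.sqrt_eq_rpow]
    congr 1
    field_simp

theorem theorem2 (lam : ℝ) (hlam : IsPerron lam) (d : ℕ)
    (hd : (minpoly ℚ lam).natDegree = d) (hd3 : 3 ≤ d) (ρ : ℝ) (hρ : ρ = spectralRatio lam) :
    haveI : NumberField ℚ⟮lam⟯ := hlam.numberField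
    dPF lam ∈ primitiveDims lam ∧
    (dPF lam : ℝ) ≤ max (2 ^ (d ^ 2) * boundThickness ℚ⟮lam⟯ ρ) (kappa ℚ⟮lam⟯ ρ : ℝ) ∧
    (dPF lam : ℝ) ≤ max (2 ^ (d ^ 2) * boundDiscr ℚ⟮lam⟯ ρ) (kappa ℚ⟮lam⟯ ρ : ℝ) := by
  have : NumberField ℚ⟮lam⟯ := hlam.numberField
  have hρ0 : 0 ≤ ρ := hρ ▸ hlam.spectralRatio_nonneg
  have hρ1 : ρ < 1 := hρ ▸ hlam.spectralRatio_lt_one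
  have hfin : Module.finrank ℚ ℚ⟮lam⟯ = d := by
    rw [IntermediateField.adjoin.finrank hlam.isIntegral.tower_top, hd]
  have hΛ : algebraMap ℚ⟮lam⟯ ℝ (hlam.toInteger : ℚ⟮lam⟯) = lam := rfl
  have hΛw : ∀ w ≠ inclusionPlace lam, w (hlam.toInteger : ℚ⟮lam⟯) ≤ ρ * lam :=
    fun w hw => hρ ▸ hlam.place_le hw
  have hj := embedding_inclusionPlace lam
  -- Nonemptiness rules out the default value `sInf ∅ = 0`, so `dPF lam` is an attained dimension.
  refine ⟨Nat.sInf_mem (primitiveDims_nonempty _ _ _ hj hΛ hρ0 hρ1 hΛw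
    (hlam.one_lt (by omega))), ?_⟩
  rcases le_or_gt lam (1 + 4 / (1 - ρ)) with hsmall | hlarge
  · have hκ : (dPF lam : ℝ) ≤ kappa ℚ⟮lam⟯ ρ := Nat.cast_le.2 <|
      (isGreatest_kappa ℚ⟮lam⟯ hρ1).2
        ⟨lam, ⟨hlam, IntermediateField.mem_adjoin_simple_self ℚ lam, hlam.one_le, hsmall⟩, rfl⟩
    exact ⟨hκ.trans (le_max_right _ _), hκ.trans (le_max_right _ _)⟩
  · have hle := dPF_le_of_large _ _ _ hj hΛ hρ0 hρ1 hΛw hlarge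
    have hτ := tauMin_rpow_le ℚ⟮lam⟯
    have hpow := pow_le_pow_sq_of_three_le hd3 hρ0 hρ1
    have hρ' : 0 < 1 - ρ := by linarith
    rw [boundThickness, boundDiscr]
    rw [hfin] at hle hτ ⊢
    have hτ0 : 0 ≤ tauMin ℚ⟮lam⟯ ^ ((d : ℝ) / 2) := Real.rpow_nonneg tauMin_nonneg _
    refine ⟨le_max_of_le_left ?_, le_max_of_le_left ?_⟩
    · refine hle.trans ?_
      rw [← mul_assoc]
      refine mul_le_mul_of_nonneg_right (le_trans ?_ hpow) hτ0
      exact le_mul_of_one_le_right (by positivity)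
        (one_le_pow₀ (one_le_pow₀ one_le_two))
    · refine hle.trans ((mul_le_mul_of_nonneg_left hτ (by positivity)).trans ?_)
      rw [← mul_assoc, ← mul_assoc]
      exact mul_le_mul_of_nonneg_right hpow (Real.sqrt_nonneg _)
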